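/- **Setting.** Let $f\in C^2(\mathbb R)$ be strictly convex, $a>0$, $T>0$. Let $u_0,w_0\in L^1(\mathbb R)\cap \mathrm{BV}(\mathbb R)$ with $|u_0(x)-w_0(x)|\le a$ for almost every $x$. Let $\Delta x,\Delta t>0$, and let $(x_{i+1/2})_{i\in\mathbb Z}$ be a uniform mesh of $\mathbb R$, $x_{i+1/2}-x_{i-1/2}=\Delta x$, with cells $K_i=[x_{i-1/2},x_{i+1/2})$. Assume the CFL condition $$\Delta t\le \frac{\Delta x}{2L},\qquad L:=\max_{v\in[U_m,U_M]}|f'(v)|,\quad U_m:=\operatorname{ess\,inf}u_0,\ U_M:=\operatorname{ess\,sup}u_0$$ (no restriction if $L=0$). **The scheme.** For $u_l\le u_r$ let $u(0-)=u(0+)$ be the minimum point of $f$ on $[u_l,u_r]$. For $u_l>u_r$ let $u(0-)=u(0+)=u_l$ if $f(u_l)>f(u_r)$, $u(0-)=u(0+)=u_r$ if $f(u_l)<f(u_r)$, and $u(0-)=u_l$, $u(0+)=u_r$ if $f(u_l)=f(u_r)$. (These are the states adjacent to the interface in the solution of the Riemann problem for $\partial_t u+\partial_t w+\partial_x f(u)=0$,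 where $w$ is the output of the Play operator of half-width $a$ with input $u$.) Write $\hat u_\pm(u_l,u_r):=u(0\pm)$ and let $g(u_l,u_r):=f(\hat u_-(u_l,u_r))=f(\hat u_+(u_l,u_r))$ be the Godunov flux. Let $$\tilde f_\gamma(u):=\begin{cases}\tfrac12 f(u)+\tfrac12 f(\gamma-a), & u<\gamma-a,\\ f(u), & \gamma-a\le u\le \gamma+a,\\ \tfrac12 f(u)+\tfrac12 f(\gamma+a), & u>\gamma+a.\end{cases}$$ There is a fast shock on the right for $(\alpha,\beta,\gamma)$ if $\beta<\gamma+a<\alpha$, $f(\beta)<f(\alpha)$ and $\frac{f(\gamma+a)-f(\beta)}{\gamma+a-\beta}<\frac12\frac{f(\alpha)-f(\gamma+a)}{\alpha-(\gamma+a)}$; there is a fast shock on the left for $(\alpha,\beta,\gamma)$ if $\beta<\gamma-a<\alpha$, $f(\alpha)<f(\beta)$ and $\frac{f(\alpha)-f(\gamma-a)}{\alpha-(\gamma-a)}>\frac12\frac{f(\gamma-a)-f(\beta)}{\gamma-a-\beta}$. Put $$h_1^+(\alpha,\beta,\gamma):=\begin{cases}\dfrac{f(\alpha)-f(\beta)}{\alpha-\beta+(\alpha-a)-\gamma}(\alpha-\beta)+f(\beta)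 & \text{if there is a fast shock on the right},\\ \tilde f_\gamma(\hat u_+(\alpha,\beta)) & \text{otherwise,}\end{cases}$$ $$h_1^-(\alpha,\beta,\gamma):=\begin{cases}\dfrac{f(\alpha)-f(\beta)}{\alpha-\beta+\gamma-(\beta+a)}(\beta-\alpha)+f(\alpha) & \text{if there is a fast shock on the left},\\ \tilde f_\gamma(\hat u_-(\alpha,\beta)) & \text{otherwise,}\end{cases}$$ and $h_2^\pm(\alpha,\beta,\gamma):=g(\alpha,\beta)-h_1^\pm(\alpha,\beta,\gamma)$. Define $u_i^0:=\frac1{\Delta x}\int_{K_i}u_0\,dx$, $w_i^0:=\frac1{\Delta x}\int_{K_i}w_0\,dx$ and, for $n\ge0$ and $i\in\mathbb Z$, $$u_i^{n+1}=u_i^n-\tfrac{\Delta t}{\Delta x}\bigl(h_1^-(u_i^n,u_{i+1}^n,w_i^n)-h_1^+(u_{i-1}^n,u_i^n,w_i^n)\bigr),$$ $$w_i^{n+1}=w_i^n-\tfrac{\Delta t}{\Delta x}\bigl(h_2^-(u_i^n,u_{i+1}^n,w_i^n)-h_2^+(u_{i-1}^n,u_i^n,w_i^n)\bigr).$$ Let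 $u^\Delta(x,t):=u_i^n$ and $w^\Delta(x,t):=w_i^n$ for $x\in K_i$, $t\in[n\Delta t,(n+1)\Delta t)$. **Claim.** $(u^\Delta,w^\Delta)$ satisfies the weak hysteresis relationship on $\mathbb R\times(0,T)$: the distributional derivative $\partial_t w^\Delta$ is a finite signed measure on $\mathbb R\times(0,T)$, and for almost every $t\in(0,T)$ the functions $u^\Delta(\cdot,t)^2-u_0^2$ and $w^\Delta(\cdot,t)^2-w_0^2$ are integrable and $$\frac12\int_{\mathbb R}\bigl(u^\Delta(x,t)^2-u_0(x)^2\bigr)\,dx+\frac12\int_{\mathbb R}\bigl(w^\Delta(x,t)^2-w_0(x)^2\bigr)\,dx\le -a\,\bigl|\partial_t w^\Delta\bigr|(\mathbb R\times(0,t)).$$ -/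

import Mathlib

open MeasureTheory Set Filter

noncomputable section

namespace PlayScheme

/-- The smallest minimum point of `f` on `[l, r]`. For a strictly convex continuous `f` and `l ≤ r`
this is the unique minimum point `u_*`; it is `l` when `f' l ≥ 0` and `r` when `f' r ≤ 0`. -/
def minPoint (f : ℝ → ℝ) (l r : ℝ) : ℝ :=
  sInf {v | v ∈ Icc l r ∧ IsMinOn f (Icc l r) v}

/-- The state `u(0-, t)`, `t > 0`, of the solution `u` of the Riemann problem with states `ul` on
the left and `ur` on the right. If `ul ≤ ur` the solution is constant or made of rarefaction waves,
and `u` is continuous at `x = 0` with value the minimum point of `f`. If `ur < ul`, all shocks move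
to the left when `f ul < f ur`, none of them is in `x < 0` when `f ur < f ul`, and there is one
stationary shock when `f ul = f ur`. -/
def traceLeft (f : ℝ → ℝ) (ul ur : ℝ) : ℝ :=
  open Classical in
  if ul ≤ ur then minPoint f ul ur else if f ul < f ur then ur else ul

/-- The state `u(0+, t)`, `t > 0`, of the solution `u` of the same Riemann problem. -/
def traceRight (f : ℝ → ℝ) (ul ur : ℝ) : ℝ :=
  open Classical in
  if ul ≤ ur then minPoint f ul ur else if f ur < f ul then ul else ur

/-- The flux takes the same value on the two sides of the interface. -/
theorem flux_trace_eq (f : ℝ → ℝ) (ul ur : ℝ) :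
    f (traceLeft f ul ur) = f (traceRight f ul ur) := by
  unfold traceLeft traceRight
  split_ifs with h1 h2 h3
  · rfl
  · exact absurd h2 (lt_asymm h3)
  · rfl
  · rfl
  · exact le_antisymm (by linarith) (by linarith)

/-- The Godunov flux `f(u(0, t))` at the interface. -/
def godunovFlux (f : ℝ → ℝ) (ul ur : ℝ) : ℝ := f (traceLeft f ul ur)

/-- The flux `f̃_w` that governs `u` where the output starts from `w` and no fast shock occurs. -/
def fTilde (f : ℝ → ℝ) (a w u : ℝ) : ℝ :=
  open Classical in
  if u < w - a then f u / 2 + f (w - a) / 2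
  else if u < w + a then f u
  else f u / 2 + f (w + a) / 2

/-- The Riemann problem with states `ul`, `ur` and right output state `wr` has a fast shock
in `x > 0`: `u` and `w` jump together, since the `u`-shock (speed `μ_r`) that would precede
the `(u, w)`-shock (speed `μ_l`) is slower than it. -/
def FastShockRight (f : ℝ → ℝ) (a ul ur wr : ℝ) : Prop :=
  ur < wr + a ∧ wr + a < ul ∧ f ur < f ul ∧
    (f (wr + a) - f ur) / ((wr + a) - ur) < (1 / 2) * ((f ul - f (wr + a)) / (ul - (wr + a)))

/-- The speed `μ` of the fast shock in `x > 0`, joining `(ul, ul - a)` to `(ur, wr)`. -/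
def speedRight (f : ℝ → ℝ) (a ul ur wr : ℝ) : ℝ :=
  (f ul - f ur) / (ul - ur + (ul - a) - wr)

/-- The Riemann problem with states `ul`, `ur` and left output state `wl` has a fast shock
in `x < 0`; here `ν_l` is the speed of the `u`-shock and `ν_r` that of the `(u, w)`-shock. -/
def FastShockLeft (f : ℝ → ℝ) (a ul ur wl : ℝ) : Prop :=
  ur < wl - a ∧ wl - a < ul ∧ f ul < f ur ∧
    (1 / 2) * ((f (wl - a) - f ur) / ((wl - a) - ur)) < (f ul - f (wl - a)) / (ul - (wl - a))

/-- The speed `ν` of the fast shock in `x < 0`, joining `(ul, wl)` to `(ur, ur + a)`. -/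
def speedLeft (f : ℝ → ℝ) (a ul ur wl : ℝ) : ℝ :=
  (f ul - f ur) / (ul - ur + wl - (ur + a))

/-- `h₁⁺(α, β, γ)`: the `u`-flux that enters a cell with state `(β, γ)` from its left interface,
when the left neighbour has `u`-state `α`. -/
def h1Plus (f : ℝ → ℝ) (a α β γ : ℝ) : ℝ :=
  open Classical in
  if FastShockRight f a α β γ then speedRight f a α β γ * (α - β) + f β
  else fTilde f a γ (traceRight f α β)

/-- `h₁⁻(α, β, γ)`: the `u`-flux that leaves a cell with state `(α, γ)` through its right interface,
when the right neighbour has `u`-state `β`. -/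
def h1Minus (f : ℝ → ℝ) (a α β γ : ℝ) : ℝ :=
  open Classical in
  if FastShockLeft f a α β γ then speedLeft f a α β γ * (β - α) + f α
  else fTilde f a γ (traceLeft f α β)

/-- `h₂⁺ = (Godunov flux) - h₁⁺` at the left interface. -/
def h2Plus (f : ℝ → ℝ) (a α β γ : ℝ) : ℝ := godunovFlux f α β - h1Plus f a α β γ

/-- `h₂⁻ = (Godunov flux) - h₁⁻` at the right interface. -/
def h2Minus (f : ℝ → ℝ) (a α β γ : ℝ) : ℝ := godunovFlux f α β - h1Minus f a α β γ

/-- The mean of `v` on the cell `[x₀ + i Δx, x₀ + (i + 1) Δx)`. -/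
def cellMean (x₀ dx : ℝ) (v : ℝ → ℝ) (i : ℤ) : ℝ :=
  (1 / dx) * ∫ x in Ico (x₀ + i * dx) (x₀ + (i + 1) * dx), v x

/-- The pair `(u_i^n, w_i^n)` computed by the finite volume scheme on the uniform mesh with cells
`[x₀ + i Δx, x₀ + (i + 1) Δx)`, `i ∈ ℤ`, with time step `Δt`. -/
def scheme (f : ℝ → ℝ) (a x₀ dx dt : ℝ) (u₀ w₀ : ℝ → ℝ) : ℕ → ℤ → ℝ × ℝ
  | 0, i => (cellMean x₀ dx u₀ i, cellMean x₀ dx w₀ i)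
  | n + 1, i =>
    let p := scheme f a x₀ dx dt u₀ w₀ n (i - 1)
    let q := scheme f a x₀ dx dt u₀ w₀ n i
    let r := scheme f a x₀ dx dt u₀ w₀ n (i + 1)
    (q.1 - dt / dx * (h1Minus f a q.1 r.1 q.2 - h1Plus f a p.1 q.1 q.2),
      q.2 - dt / dx * (h2Minus f a q.1 r.1 q.2 - h2Plus f a p.1 q.1 q.2))

/-- `u^Δ(x, t) = u_i^n` for `x` in the `i`-th cell and `t ∈ [n Δt, (n + 1) Δt)`. -/
def uApprox (f : ℝ → ℝ) (a x₀ dx dt : ℝ) (u₀ w₀ : ℝ → ℝ) (x t : ℝ) : ℝ :=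
  (scheme f a x₀ dx dt u₀ w₀ ⌊t / dt⌋₊ ⌊(x - x₀) / dx⌋).1

/-- `w^Δ(x, t) = w_i^n` for `x` in the `i`-th cell and `t ∈ [n Δt, (n + 1) Δt)`. -/
def wApprox (f : ℝ → ℝ) (a x₀ dx dt : ℝ) (u₀ w₀ : ℝ → ℝ) (x t : ℝ) : ℝ :=
  (scheme f a x₀ dx dt u₀ w₀ ⌊t / dt⌋₊ ⌊(x - x₀) / dx⌋).2

/-- `v ∈ BV(ℝ)`: some function equal to `v` almost everywhere has bounded pointwise variation. -/
def IsBV (v : ℝ → ℝ) : Prop :=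
  ∃ g : ℝ → ℝ, v =ᵐ[volume] g ∧ BoundedVariationOn g univ

/-- `L`, the maximum of `|f'|` on `[U_m, U_M]`, where `U_m` and `U_M` are the essential infimum and
supremum of `u₀`. -/
def maxSpeed (f u₀ : ℝ → ℝ) : ℝ :=
  sSup ((fun v => |deriv f v|) '' Icc (essInf u₀ volume) (essSup u₀ volume))

/-- `Δt ≤ Δx / (2 L)`, which is no restriction when `L = 0`. -/
def CFL (f u₀ : ℝ → ℝ) (dx dt : ℝ) : Prop :=
  dt * (2 * maxSpeed f u₀) ≤ dx

/-- The finite signed measure `μ` is the distributional derivative `∂_t w` on `ℝ × (0, T)`. -/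
structure IsTimeDerivative (T : ℝ) (w : ℝ → ℝ → ℝ) (μ : SignedMeasure (ℝ × ℝ)) : Prop where
  locallyIntegrable :
    LocallyIntegrableOn (fun z : ℝ × ℝ => w z.1 z.2) (univ ×ˢ Ioo 0 T) volume
  integral_eq : ∀ φ : ℝ × ℝ → ℝ, ContDiff ℝ 1 φ → HasCompactSupport φ →
    tsupport φ ⊆ univ ×ˢ Ioo 0 T →
    ∫ z, φ z ∂μ.toJordanDecomposition.posPart - ∫ z, φ z ∂μ.toJordanDecomposition.negPart
      = -∫ z : ℝ × ℝ, w z.1 z.2 * deriv (fun s => φ (z.1, s)) z.2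

/-- The weak hysteresis relationship on `ℝ × (0, T)`: `∂_t w` is a finite measure, and for almost
every `t ∈ (0, T)` the two integrals on the left are well defined and
`½ ∫ (u(x,t)² - u₀²) + ½ ∫ (w(x,t)² - w₀²) ≤ - a |∂_t w|(ℝ × (0, t))`. -/
def WeakHysteresis (a T : ℝ) (u₀ w₀ : ℝ → ℝ) (u w : ℝ → ℝ → ℝ) : Prop :=
  ∃ μ : SignedMeasure (ℝ × ℝ), IsTimeDerivative T w μ ∧
    ∀ᵐ t ∂(volume.restrict (Ioo 0 T)),
      Integrable (fun x => u x t ^ 2 - u₀ x ^ 2) ∧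
      Integrable (fun x => w x t ^ 2 - w₀ x ^ 2) ∧
      (1 / 2) * (∫ x, (u x t ^ 2 - u₀ x ^ 2)) + (1 / 2) * (∫ x, (w x t ^ 2 - w₀ x ^ 2))
        ≤ -a * (μ.totalVariation (univ ×ˢ Ioo 0 t)).toReal

end PlayScheme

end

/-! Multiplying `u_t + w_t + f(u)_x = 0` by `u` gives `(u²/2)_t + u w_t + q(u)_x = 0` with `q' = u
f'`. The Play operator moves `w` only when `|u - w| = a`, in the direction of `u - w`, so `u w_t =
(w²/2)_t + a |w_t|`. Hence the energy `(u² + w²)/2` has flux `q` and loses at least `a |w_t|`, with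
a further loss at shocks. The proof is a discrete form of this balance.

A new cell value is the mean of two half-cell values, one for the waves entering through each
interface; half a cell has width `Δx/2`, whence the factor `k = 2 Δt/Δx`. The core is
`halfCell_right`: on half a cell, the energy increment plus `a |W - γ|` is at most `k` times the
difference of `q` between the interface state and the cell state. It is proved directly from the
flux formulas, using a chord estimate for shocks (`le_entropyFlux_sub`), a CFL estimate for
rarefactions (`entropyFlux_sub_le`), and the fast shock condition where `u` and `w` jump together.
The left-moving case follows by reflection.

In `cellStep`, convexity of the square combines the two halves. Since `q` does not increase from the
left to the right trace at an interface, a single flux per interface suffices, and the fluxes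
telescope over the cells (`Admissible.step`). Summing over the time steps bounds the energy plus `a`
times all jumps of `w` by the energy of the cell means, hence by that of the data. Finally, the
distributional derivative of a step function is carried by the discrete times with the jumps as
density, so these jumps control its total variation. -/

noncomputable section

namespace PlayScheme

/-! ### Entropy flux estimates for shocks and rarefactions -/

/-- The flux `q` with `q' = u f'` of the entropy `u² / 2`. -/
def entropyFlux (f : ℝ → ℝ) (v : ℝ) : ℝ := v * f v - ∫ s in (0 : ℝ)..v, f s

theorem entropyFlux_sub {f : ℝ → ℝ} (hf : Continuous f) (x y : ℝ) :
    entropyFlux f x - entropyFlux f y = x * f x - y * f y - ∫ s in y..x, f s := by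
  have := intervalIntegral.integral_add_adjacent_intervals (hf.intervalIntegrable 0 y (μ := volume))
    (hf.intervalIntegrable y x)
  unfold entropyFlux
  linarith

theorem entropyFlux_neg (f : ℝ → ℝ) (v : ℝ) :
    entropyFlux (fun x => f (-x)) (-v) = -entropyFlux f v := by
  unfold entropyFlux
  rw [intervalIntegral.integral_comp_neg, intervalIntegral.integral_symm]
  simp only [neg_neg, neg_zero]
  ring

/-- Across a shock the entropy is dissipated. -/
theorem le_entropyFlux_sub {f : ℝ → ℝ} (hf : Continuous f) (hc : ConvexOn ℝ univ f) {x y : ℝ}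
    (hyx : y ≤ x) :
    (x + y) / 2 * (f x - f y) ≤ entropyFlux f x - entropyFlux f y := by
  rw [entropyFlux_sub hf]
  rcases hyx.eq_or_lt with rfl | hlt
  · simp
  set m := (f x - f y) / (x - y) with hm
  have hmx : m * (x - y) = f x - f y := div_mul_cancel₀ _ (by linarith)
  -- The chord lies above the graph, so the integral is at most the area of the trapezoid.
  have hle : ∫ s in y..x, f s ≤ ∫ s in y..x, (f y - m * y + m * s) := by
    apply intervalIntegral.integral_mono_on hyx (hf.intervalIntegrable _ _)
      (by apply Continuous.intervalIntegrable; fun_prop)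
    intro s hs
    have h := hc.2 (mem_univ y) (mem_univ x)
      (div_nonneg (sub_nonneg.2 hs.2) (sub_nonneg.2 hyx))
      (div_nonneg (sub_nonneg.2 hs.1) (sub_nonneg.2 hyx))
      (by rw [← add_div, div_eq_one_iff_eq (by linarith)]; ring)
    have hxy : x - y ≠ 0 := by linarith
    have e1 : ((x - s) / (x - y)) • y + ((s - y) / (x - y)) • x = s := by
      simp only [smul_eq_mul]; field_simp; ring
    have e2 : ((x - s) / (x - y)) • f y + ((s - y) / (x - y)) • f x = f y - m * y + m * s := by
      simp only [smul_eq_mul, hm]; field_simp; ring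
    rwa [e1, e2] at h
  have hev : ∫ s in y..x, (f y - m * y + m * s) = (x - y) * (f x + f y) / 2 := by
    rw [intervalIntegral.integral_add (by simp)
      (by apply Continuous.intervalIntegrable; fun_prop), intervalIntegral.integral_const,
      intervalIntegral.integral_const_mul, integral_id, smul_eq_mul]
    linear_combination (x - y) / 2 * hmx
  rw [hev] at hle
  linarith

/-- In a rarefaction averaging dissipates the entropy as long as no wave is faster than `1 / k`. -/
theorem entropyFlux_sub_le {f : ℝ → ℝ} (hf : Continuous f) {k s x : ℝ} (hk : 0 ≤ k) (hsx : s ≤ x)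
    (hmin : ∀ v ∈ Icc s x, f s ≤ f v)
    (hlip : ∀ v ∈ Icc s x, k * (f x - f v) ≤ x - v) :
    k * (entropyFlux f x - entropyFlux f s)
      ≤ x * (k * (f x - f s)) - (k * (f x - f s)) ^ 2 / 2 := by
  set d := k * (f x - f s) with hd
  have hd0 : 0 ≤ d := mul_nonneg hk (by linarith [hmin x ⟨hsx, le_rfl⟩])
  have hds : s ≤ x - d := by linarith [hlip s ⟨le_rfl, hsx⟩]
  have hint : ∀ p q : ℝ, IntervalIntegrable (fun v => k * (f v - f s)) volume p q := fun p q => by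
    apply Continuous.intervalIntegrable; fun_prop
  have h1 : 0 ≤ ∫ v in s..(x - d), k * (f v - f s) :=
    intervalIntegral.integral_nonneg hds fun v hv =>
      mul_nonneg hk (by linarith [hmin v ⟨hv.1, by linarith [hv.2]⟩])
  -- By `hlip`, `k (f v - f s)` stays above the line of slope one that takes the value `d` at `x`;
  -- the triangle below that line has area `d² / 2`.
  have h2 : ∫ v in (x - d)..x, (d - x + v) ≤ ∫ v in (x - d)..x, k * (f v - f s) := by
    apply intervalIntegral.integral_mono_on (by linarith)
      (by apply Continuous.intervalIntegrable; fun_prop) (hint _ _)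
    intro v hv
    have := hlip v ⟨by linarith [hv.1], hv.2⟩
    linarith
  have h3 : ∫ v in (x - d)..x, (d - x + v) = d ^ 2 / 2 := by
    rw [intervalIntegral.integral_add (by simp)
      (by apply Continuous.intervalIntegrable; fun_prop), intervalIntegral.integral_const,
      integral_id, smul_eq_mul]
    ring
  have h4 := intervalIntegral.integral_add_adjacent_intervals (hint s (x - d)) (hint (x - d) x)
  have h5 : ∫ v in s..x, k * (f v - f s) = k * (∫ v in s..x, f v) - k * (x - s) * f s := by
    rw [intervalIntegral.integral_const_mul, intervalIntegral.integral_sub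
      (hf.intervalIntegrable _ _) (by simp), intervalIntegral.integral_const, smul_eq_mul]
    ring
  rw [entropyFlux_sub hf]
  have : k * (x * f x - s * f s - ∫ v in s..x, f v)
      = x * d - ∫ v in s..x, k * (f v - f s) := by
    rw [h5, hd]; ring
  rw [this]
  linarith

/-! ### Interface states and the reflection symmetry -/

theorem minPoint_spec {f : ℝ → ℝ} (hf : Continuous f) (hc : StrictConvexOn ℝ univ f) {l r : ℝ}
    (h : l ≤ r) : minPoint f l r ∈ Icc l r ∧ IsMinOn f (Icc l r) (minPoint f l r) := by
  obtain ⟨v, hv, hmin⟩ := isCompact_Icc.exists_isMinOn (nonempty_Icc.2 h) hf.continuousOn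
  have hset : {v | v ∈ Icc l r ∧ IsMinOn f (Icc l r) v} = {v} := by
    ext y
    refine ⟨fun hy => ?_, ?_⟩
    · exact (hc.subset (subset_univ _) (convex_Icc l r)).eq_of_isMinOn hy.2 hmin hy.1 hv
    · rintro rfl
      exact ⟨hv, hmin⟩
  rw [minPoint, hset, csInf_singleton]
  exact ⟨hv, hmin⟩

theorem minPoint_neg {f : ℝ → ℝ} (hf : Continuous f) (hc : StrictConvexOn ℝ univ f)
    (hc' : StrictConvexOn ℝ univ (fun x => f (-x))) {l r : ℝ} (h : l ≤ r) :
    minPoint (fun x => f (-x)) (-r) (-l) = -minPoint f l r := by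
  obtain ⟨h1, h2⟩ := minPoint_spec hf hc h
  obtain ⟨h3, h4⟩ := minPoint_spec (hf.comp continuous_neg) hc' (neg_le_neg h)
  refine (hc'.subset (subset_univ _) (convex_Icc (-r) (-l))).eq_of_isMinOn h4 ?_ h3
    ⟨by linarith [h1.2], by linarith [h1.1]⟩
  intro x hx
  simpa using h2 (show -x ∈ Icc l r from ⟨by linarith [hx.2], by linarith [hx.1]⟩)

theorem strictConvexOn_comp_neg {f : ℝ → ℝ} (hc : StrictConvexOn ℝ univ f) :
    StrictConvexOn ℝ univ (fun x => f (-x)) := by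
  refine ⟨convex_univ, fun x _ y _ hxy s t hs ht hst => ?_⟩
  have := hc.2 (mem_univ (-x)) (mem_univ (-y)) (by simpa using hxy) hs ht hst
  simp only [smul_eq_mul] at this ⊢
  convert this using 2
  ring

theorem traceLeft_mem {f : ℝ → ℝ} (hf : Continuous f) (hc : StrictConvexOn ℝ univ f) (α β : ℝ) :
    traceLeft f α β ∈ uIcc α β := by
  unfold traceLeft
  split_ifs with h1 h2
  · exact Icc_subset_uIcc (minPoint_spec hf hc h1).1
  · exact right_mem_uIcc
  · exact left_mem_uIcc

theorem traceRight_comp_neg {f : ℝ → ℝ} (hf : Continuous f) (hc : StrictConvexOn ℝ univ f)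
    (α β : ℝ) : traceRight (fun x => f (-x)) (-β) (-α) = -traceLeft f α β := by
  unfold traceLeft traceRight
  simp only [neg_le_neg_iff, neg_neg]
  split_ifs with h1
  · exact minPoint_neg hf hc (strictConvexOn_comp_neg hc) h1
  · rfl
  · rfl

/-- The traces differ only at a stationary shock, where `f` agrees on both sides and the shock
inequality has a vanishing left-hand side. -/
theorem entropyFlux_traceRight_le {f : ℝ → ℝ} (hf : Continuous f) (hc : ConvexOn ℝ univ f)
    (α β : ℝ) :
    entropyFlux f (traceRight f α β) ≤ entropyFlux f (traceLeft f α β) := by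
  unfold traceLeft traceRight
  split_ifs with h1 h2 h3 h3
  · rfl
  · exact absurd h2 (lt_asymm h3)
  · rfl
  · rfl
  · have := le_entropyFlux_sub hf hc (not_le.1 h1).le
    rw [le_antisymm (not_lt.1 h2) (not_lt.1 h3)] at this
    linarith

theorem fTilde_comp_neg (f : ℝ → ℝ) {a : ℝ} (ha : 0 < a) (γ v : ℝ) :
    fTilde (fun x => f (-x)) a (-γ) (-v) = fTilde f a γ v := by
  unfold fTilde
  beta_reduce
  rw [show -(-γ - a) = γ + a by ring, show -(-γ + a) = γ - a by ring, neg_neg]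
  split_ifs with h1 h2 h3 h4 h5 h6 h7 h8 <;> first | rfl | linarith | skip
  -- The strict inequalities in `fTilde` are not symmetric under reflection; what remains is `v = γ
  -- ± a`, where the two formulas agree.
  all_goals
    first
    | (rw [show v = γ + a by linarith]; ring)
    | (rw [show v = γ - a by linarith]; ring)

theorem fastShockRight_comp_neg (f : ℝ → ℝ) (a α β γ : ℝ) :
    FastShockRight (fun x => f (-x)) a (-β) (-α) (-γ) ↔ FastShockLeft f a α β γ := by
  unfold FastShockRight FastShockLeft
  beta_reduce
  rw [show -(-γ + a) = γ - a by ring, show -γ + a - -α = α - (γ - a) by ring,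
    show -β - (-γ + a) = γ - a - β by ring]
  simp only [neg_neg]
  have e1 : (f (γ - a) - f α) / (α - (γ - a)) = -((f α - f (γ - a)) / (α - (γ - a))) := by
    rw [← neg_div, neg_sub]
  have e2 : (f β - f (γ - a)) / (γ - a - β) = -((f (γ - a) - f β) / (γ - a - β)) := by
    rw [← neg_div, neg_sub]
  rw [e1, e2]
  constructor
  · rintro ⟨h1, h2, h3, h4⟩
    exact ⟨by linarith, by linarith, h3, by linarith⟩
  · rintro ⟨h1, h2, h3, h4⟩
    exact ⟨by linarith, by linarith, h3, by linarith⟩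

/-- Changing the signs of `x`, `u` and `w` preserves the equation with flux `f (-·)` and exchanges
the two sides of an interface. -/
theorem h1Plus_comp_neg {f : ℝ → ℝ} (hf : Continuous f) (hc : StrictConvexOn ℝ univ f) {a : ℝ}
    (ha : 0 < a) (α β γ : ℝ) :
    h1Plus (fun x => f (-x)) a (-β) (-α) (-γ) = h1Minus f a α β γ := by
  unfold h1Plus h1Minus
  rw [traceRight_comp_neg hf hc, fTilde_comp_neg f ha, fastShockRight_comp_neg]
  congr 1
  unfold speedRight speedLeft
  simp only [neg_neg]
  rw [show -β - -α + (-β - a) - -γ = α - β + γ - (β + a) by ring,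
    show f β - f α = -(f α - f β) by ring, neg_div]
  ring

theorem h2Plus_comp_neg {f : ℝ → ℝ} (hf : Continuous f) (hc : StrictConvexOn ℝ univ f) {a : ℝ}
    (ha : 0 < a) (α β γ : ℝ) :
    h2Plus (fun x => f (-x)) a (-β) (-α) (-γ) = h2Minus f a α β γ := by
  unfold h2Plus h2Minus
  rw [h1Plus_comp_neg hf hc ha, godunovFlux, flux_trace_eq (fun x => f (-x)), traceRight_comp_neg hf hc, neg_neg]
  rfl

/-! ### Energy balance on half a cell -/

/-- The averages `U`, `W` over the right half of the fan of a Riemann problem with right state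
`(β, γ)`: maximum principle, control of the output and dissipation. -/
structure HalfCell (a α β γ U W e : ℝ) : Prop where
  mem : U ∈ uIcc α β
  output : |W - γ| ≤ |α - β|
  strip : |U - W| ≤ a
  dissipation : (U ^ 2 - β ^ 2) / 2 + (W ^ 2 - γ ^ 2) / 2 + a * |W - γ| ≤ e

theorem halfCell_rarefaction {f : ℝ → ℝ} (hf : Continuous f) (hc : StrictConvexOn ℝ univ f)
    {a k α β γ : ℝ} (hk : 0 < k)
    (hlip : ∀ x ∈ uIcc α β, ∀ y ∈ uIcc α β, k * |f x - f y| ≤ |x - y|) (hγ : |β - γ| ≤ a)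
    (h : α ≤ β) :
    HalfCell a α β γ (β + k * (fTilde f a γ (minPoint f α β) - f β))
      (γ + k * (f (minPoint f α β) - fTilde f a γ (minPoint f α β)))
      (k * (entropyFlux f (minPoint f α β) - entropyFlux f β)) := by
  rw [uIcc_of_le h] at hlip
  obtain ⟨hs, hmin⟩ := minPoint_spec hf hc h
  set s := minPoint f α β
  obtain ⟨hγ1, hγ2⟩ := abs_le.1 hγ
  have hmono : ∀ x ∈ Icc s β, ∀ y ∈ Icc x β, f x ≤ f y := by
    intro x hx y hy
    have h1 := hc.convexOn.le_max_of_mem_Icc (mem_univ s) (mem_univ y) ⟨hx.1, hy.1⟩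
    exact h1.trans_eq (max_eq_right (hmin ⟨by linarith [hs.1, hx.1, hy.1], hy.2⟩))
  have hlip' : ∀ x ∈ Icc s β, ∀ y ∈ Icc x β, k * (f y - f x) ≤ y - x := by
    intro x hx y hy
    have h1 := hlip y ⟨by linarith [hs.1, hx.1, hy.1], hy.2⟩ x ⟨by linarith [hs.1, hx.1], hx.2⟩
    rw [abs_of_nonneg (sub_nonneg.2 hy.1)] at h1
    exact (mul_le_mul_of_nonneg_left (le_abs_self _) hk.le).trans h1
  have hA : ∀ x ∈ Icc s β, ∀ y ∈ Icc x β, k * (entropyFlux f y - entropyFlux f x)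
      ≤ y * (k * (f y - f x)) - (k * (f y - f x)) ^ 2 / 2 := fun x hx y hy =>
    entropyFlux_sub_le hf hk.le hy.1 (fun v hv => hmono x hx v ⟨hv.1, hv.2.trans hy.2⟩)
      fun v hv => hlip' v ⟨hx.1.trans hv.1, hv.2.trans hy.2⟩ y ⟨hv.2, hy.2⟩
  have hsβ : s ∈ Icc s β := ⟨le_rfl, hs.2⟩
  by_cases hlt : s < γ - a
  · have hc1 : γ - a ∈ Icc s β := ⟨hlt.le, by linarith⟩
    have hc2 : β ∈ Icc (γ - a) β := ⟨by linarith, le_rfl⟩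
    have e : fTilde f a γ s = f s / 2 + f (γ - a) / 2 := by rw [fTilde, if_pos hlt]
    have hd1 : 0 ≤ k * (f β - f (γ - a)) :=
      mul_nonneg hk.le (sub_nonneg.2 (hmono _ hc1 _ hc2))
    have hd2 : 0 ≤ k * (f (γ - a) - f s) :=
      mul_nonneg hk.le (sub_nonneg.2 (hmono _ hsβ _ hc1))
    have hl1 := hlip' _ hc1 _ hc2
    have hl2 := hlip' _ hsβ _ hc1
    have hA1 := hA _ hc1 _ hc2
    have hA2 := hA _ hsβ _ hc1
    -- `d1` comes from the part of the fan where only `u` moves, `d2` from the part below `γ - a`,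
    -- where `u` and `w` move together and share the change equally. The shared `d2 / 2` cancels in
    -- `U - W`.
    obtain ⟨d1, hd1'⟩ : ∃ d, d = k * (f β - f (γ - a)) := ⟨_, rfl⟩
    obtain ⟨d2, hd2'⟩ : ∃ d, d = k * (f (γ - a) - f s) := ⟨_, rfl⟩
    rw [← hd1'] at hd1 hl1 hA1
    rw [← hd2'] at hd2 hl2 hA2
    have eU : β + k * (fTilde f a γ s - f β) = β - d1 - d2 / 2 := by rw [e, hd1', hd2']; ring
    have eW : γ + k * (f s - fTilde f a γ s) = γ - d2 / 2 := by rw [e, hd2']; ring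
    rw [eU, eW]
    have habs : |γ - d2 / 2 - γ| = d2 / 2 := by
      rw [show γ - d2 / 2 - γ = -(d2 / 2) by ring, abs_neg, abs_of_nonneg (by linarith)]
    refine ⟨?_, ?_, ?_, ?_⟩
    · rw [uIcc_of_le h]
      exact ⟨by linarith [hs.1], by linarith⟩
    · rw [habs, abs_sub_comm, abs_of_nonneg (by linarith)]
      linarith [hs.1]
    · rw [abs_le]
      constructor <;> linarith
    · rw [habs]
      nlinarith [mul_nonneg hd2 (sub_nonneg.2 hl1), mul_nonneg hd2 hd2]
  · push Not at hlt
    have e : fTilde f a γ s = f s := by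
      unfold fTilde
      rw [if_neg (not_lt.2 hlt)]
      split_ifs with h1
      · rfl
      · rw [show γ + a = s by linarith [hs.2]]; ring
    have hβ : β ∈ Icc s β := ⟨hs.2, le_rfl⟩
    have hd := mul_nonneg hk.le (sub_nonneg.2 (hmono _ hsβ _ hβ))
    have hl := hlip' _ hsβ _ hβ
    have hA1 := hA _ hsβ _ hβ
    obtain ⟨d, hd'⟩ : ∃ d, d = k * (f β - f s) := ⟨_, rfl⟩
    rw [← hd'] at hd hl hA1
    have eU : β + k * (fTilde f a γ s - f β) = β - d := by rw [e, hd']; ring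
    have eW : γ + k * (f s - fTilde f a γ s) = γ := by rw [e]; ring
    rw [eU, eW]
    refine ⟨?_, by simp, ?_, ?_⟩
    · rw [uIcc_of_le h]
      exact ⟨by linarith [hs.1], by linarith⟩
    · rw [abs_le]
      constructor <;> linarith
    · simp only [sub_self, abs_zero]
      linarith

/-- The shock inequality on all of `[β, α]` would be too weak. Splitting at `c = γ + a` and using
that the joint shock is at least as fast as the chord over `[β, c]` gives exactly the required
energy. -/
theorem halfCell_fastShock {f : ℝ → ℝ} (hf : Continuous f) (hc : StrictConvexOn ℝ univ f)
    {a k α β γ : ℝ} (hk : 0 < k)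
    (hlip : ∀ x ∈ uIcc α β, ∀ y ∈ uIcc α β, k * |f x - f y| ≤ |x - y|) (hγ : |β - γ| ≤ a)
    (h : FastShockRight f a α β γ) :
    HalfCell a α β γ (β + k * (speedRight f a α β γ * (α - β) + f β - f β))
      (γ + k * (f α - (speedRight f a α β γ * (α - β) + f β)))
      (k * (entropyFlux f α - entropyFlux f β)) := by
  obtain ⟨h1, h2, h3, h4⟩ := h
  obtain ⟨hγ1, hγ2⟩ := abs_le.1 hγ
  obtain ⟨c, hcdef⟩ : ∃ c, c = γ + a := ⟨_, rfl⟩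
  rw [← hcdef] at h1 h2 h4
  have hden : 0 < 2 * α - β - c := by linarith
  have hμ : speedRight f a α β γ * (2 * α - β - c) = f α - f β := by
    rw [speedRight, show α - β + (α - a) - γ = 2 * α - β - c by rw [hcdef]; ring]
    exact div_mul_cancel₀ _ hden.ne'
  -- `θ` is the fraction of the half cell swept by the shock, so `U` and `W` are convex combinations
  -- of the states on its two sides.
  obtain ⟨θ, hθ⟩ : ∃ θ, θ = k * speedRight f a α β γ := ⟨_, rfl⟩
  have hθF : θ * (2 * α - β - c) = k * (f α - f β) := by rw [hθ, ← hμ]; ring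
  have hl := hlip α left_mem_uIcc β right_mem_uIcc
  rw [abs_of_pos (by linarith), abs_of_pos (by linarith)] at hl
  have hθ0 : 0 ≤ θ := by
    by_contra hneg
    have := mul_pos hk (sub_pos.2 h3)
    nlinarith [mul_pos (neg_pos.2 (not_le.1 hneg)) hden]
  have hθ1 : θ ≤ 1 := by
    by_contra hneg
    nlinarith [mul_pos (sub_pos.2 (not_le.1 hneg)) hden]
  have eU : β + k * (speedRight f a α β γ * (α - β) + f β - f β) = β + θ * (α - β) := by
    rw [hθ]; ring
  have eW : γ + k * (f α - (speedRight f a α β γ * (α - β) + f β)) = γ + θ * (α - c) := by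
    linear_combination (-(α - c)) * hθ - k * hμ
  rw [eU, eW]
  have hp : 0 ≤ θ * (α - c) := mul_nonneg hθ0 (by linarith)
  have hp2 : θ * (α - c) ≤ α - c := mul_le_of_le_one_left (by linarith) hθ1
  have habs : |γ + θ * (α - c) - γ| = θ * (α - c) := by
    rw [add_sub_cancel_left, abs_of_nonneg hp]
  refine ⟨?_, ?_, ?_, ?_⟩
  · rw [uIcc_of_ge (by linarith)]
    exact ⟨by nlinarith, by nlinarith⟩
  · rw [habs, abs_of_pos (by linarith)]
    linarith
  · rw [abs_le]
    constructor <;> nlinarith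
  · rw [habs]
    have hB1 := le_entropyFlux_sub hf hc.convexOn h2.le
    have hB2 := le_entropyFlux_sub hf hc.convexOn h1.le
    -- The fast shock condition, cleared of denominators: the chord slope over `[β, c]` is at most
    -- the speed of the joint shock.
    have hfast : (f c - f β) * (2 * α - β - c) ≤ (f α - f β) * (c - β) := by
      rw [← mul_div_assoc, div_lt_div_iff₀ (by linarith) (by linarith)] at h4
      linarith
    have hfast' : k * (f c - f β) ≤ θ * (c - β) := by
      refine le_of_mul_le_mul_right ?_ hden
      have := mul_le_mul_of_nonneg_left hfast hk.le
      calc k * (f c - f β) * (2 * α - β - c) ≤ k * ((f α - f β) * (c - β)) := by linarith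
        _ = θ * (c - β) * (2 * α - β - c) := by linear_combination (-(c - β)) * hθF
    have hE : θ * (α ^ 2 - (β ^ 2 + c ^ 2) / 2) ≤ k * (entropyFlux f α - entropyFlux f β) := by
      have hB := mul_le_mul_of_nonneg_left (add_le_add hB1 hB2) hk.le
      have hm := mul_le_mul_of_nonneg_left hfast' (show 0 ≤ (α - β) / 2 by linarith)
      have e : k * ((α + c) / 2 * (f α - f c) + (c + β) / 2 * (f c - f β))
          = (α + c) / 2 * (θ * (2 * α - β - c)) - (α - β) / 2 * (k * (f c - f β)) := by
        rw [hθF]; ring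
      rw [e] at hB
      nlinarith
    refine le_trans ?_ hE
    have hθθ : 0 ≤ θ * (1 - θ) := mul_nonneg hθ0 (by linarith)
    rw [show γ = c - a by linarith]
    -- The two terms are the convexity defects of the square in the averages `U` and `W`.
    linarith [mul_nonneg hθθ (sq_nonneg (α - β)), mul_nonneg hθθ (sq_nonneg (α - c))]

theorem halfCell_shock {f : ℝ → ℝ} (hf : Continuous f) (hc : StrictConvexOn ℝ univ f)
    {a k α β γ : ℝ} (hk : 0 < k)
    (hlip : ∀ x ∈ uIcc α β, ∀ y ∈ uIcc α β, k * |f x - f y| ≤ |x - y|) (hγ : |β - γ| ≤ a)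
    (hβα : β < α) (h3 : f β < f α) (h : ¬FastShockRight f a α β γ) :
    HalfCell a α β γ (β + k * (fTilde f a γ α - f β)) (γ + k * (f α - fTilde f a γ α))
      (k * (entropyFlux f α - entropyFlux f β)) := by
  rw [uIcc_of_ge hβα.le] at hlip
  obtain ⟨hγ1, hγ2⟩ := abs_le.1 hγ
  have hlip' : ∀ x ∈ Icc β α, ∀ y ∈ Icc x α, k * (f y - f x) ≤ y - x := by
    intro x hx y hy
    have h1 := hlip y ⟨hx.1.trans hy.1, hy.2⟩ x ⟨hx.1, hx.2⟩
    rw [abs_of_nonneg (sub_nonneg.2 hy.1)] at h1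
    exact (mul_le_mul_of_nonneg_left (le_abs_self _) hk.le).trans h1
  by_cases hα : γ + a < α
  · obtain ⟨c, hcdef⟩ : ∃ c, c = γ + a := ⟨_, rfl⟩
    have e : fTilde f a γ α = f α / 2 + f c / 2 := by
      rw [fTilde, if_neg (by linarith), if_neg (by linarith), hcdef]
    have hβc : β ≤ c := by linarith
    rw [← hcdef] at hα
    have hfc : f c ≤ f α := by
      refine (hc.convexOn.le_max_of_mem_Icc (mem_univ β) (mem_univ α) ⟨hβc, hα.le⟩).trans_eq ?_
      exact max_eq_right h3.le
    -- This is the only use of the absence of a fast shock: otherwise the `u`-shock would have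
    -- negative speed and the following one positive speed.
    have hfβ : f β ≤ f c := by
      by_contra hlt
      push Not at hlt
      have hβc' : β < c := lt_of_le_of_ne hβc fun hh => by rw [hh] at hlt; exact lt_irrefl _ hlt
      refine h ⟨by rwa [← hcdef], by rwa [← hcdef], h3, ?_⟩
      rw [← hcdef]
      have n1 : (f c - f β) / (c - β) < 0 := div_neg_of_neg_of_pos (by linarith) (by linarith)
      have n2 : 0 < (f α - f c) / (α - c) := div_pos (by linarith) (by linarith)
      linarith
    have hd1 := mul_nonneg hk.le (sub_nonneg.2 hfβ)
    have hd2 := mul_nonneg hk.le (sub_nonneg.2 hfc)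
    have hl1 := hlip' β ⟨le_rfl, hβα.le⟩ c ⟨hβc, hα.le⟩
    have hl2 := hlip' c ⟨hβc, hα.le⟩ α ⟨hα.le, le_rfl⟩
    have hB1 := mul_le_mul_of_nonneg_left (le_entropyFlux_sub hf hc.convexOn hβc) hk.le
    have hB2 := mul_le_mul_of_nonneg_left (le_entropyFlux_sub hf hc.convexOn hα.le) hk.le
    rw [mul_left_comm] at hB1 hB2
    obtain ⟨d1, hd1'⟩ : ∃ d, d = k * (f c - f β) := ⟨_, rfl⟩
    obtain ⟨d2, hd2'⟩ : ∃ d, d = k * (f α - f c) := ⟨_, rfl⟩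
    rw [← hd1'] at hd1 hl1 hB1
    rw [← hd2'] at hd2 hl2 hB2
    have eU : β + k * (fTilde f a γ α - f β) = β + d1 + d2 / 2 := by rw [e, hd1', hd2']; ring
    have eW : γ + k * (f α - fTilde f a γ α) = γ + d2 / 2 := by rw [e, hd2']; ring
    rw [eU, eW]
    have habs : |γ + d2 / 2 - γ| = d2 / 2 := by
      rw [add_sub_cancel_left, abs_of_nonneg (by linarith)]
    refine ⟨?_, ?_, ?_, ?_⟩
    · rw [uIcc_of_ge hβα.le]
      exact ⟨by linarith, by linarith⟩
    · rw [habs, abs_of_pos (by linarith)]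
      linarith
    · rw [abs_le]
      constructor <;> linarith
    · rw [habs]
      rw [show γ = c - a by linarith]
      nlinarith [mul_nonneg hd2 (sub_nonneg.2 hl1), mul_nonneg hd2 (sub_nonneg.2 hl2),
        mul_nonneg hd1 (sub_nonneg.2 hl1)]
  · push Not at hα
    have e : fTilde f a γ α = f α := by
      unfold fTilde
      rw [if_neg (by linarith)]
      split_ifs with h1
      · rfl
      · rw [show γ + a = α by linarith]; ring
    have hd := mul_pos hk (sub_pos.2 h3)
    have hl := hlip' β ⟨le_rfl, hβα.le⟩ α ⟨hβα.le, le_rfl⟩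
    have hB := mul_le_mul_of_nonneg_left (le_entropyFlux_sub hf hc.convexOn hβα.le) hk.le
    rw [mul_left_comm] at hB
    obtain ⟨d, hd'⟩ : ∃ d, d = k * (f α - f β) := ⟨_, rfl⟩
    rw [← hd'] at hd hl hB
    have eW : γ + k * (f α - fTilde f a γ α) = γ := by rw [e]; ring
    rw [eW, e, ← hd']
    refine ⟨?_, by simp, ?_, ?_⟩
    · rw [uIcc_of_ge hβα.le]
      exact ⟨by linarith, by linarith⟩
    · rw [abs_le]
      constructor <;> linarith
    · simp only [sub_self, abs_zero]
      nlinarith [mul_nonneg hd.le (sub_nonneg.2 hl)]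

/-- The interface state selects the wave pattern. If `β < α` and `f α ≤ f β`, no wave enters and the
half cell keeps its state. -/
theorem halfCell_right {f : ℝ → ℝ} (hf : Continuous f) (hc : StrictConvexOn ℝ univ f)
    {a k α β γ : ℝ} (hk : 0 < k)
    (hlip : ∀ x ∈ uIcc α β, ∀ y ∈ uIcc α β, k * |f x - f y| ≤ |x - y|) (hγ : |β - γ| ≤ a) :
    HalfCell a α β γ (β + k * (h1Plus f a α β γ - f β)) (γ + k * h2Plus f a α β γ)
      (k * (entropyFlux f (traceRight f α β) - entropyFlux f β)) := by
  rw [h2Plus, godunovFlux, flux_trace_eq f]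
  by_cases hfast : FastShockRight f a α β γ
  · have e : traceRight f α β = α := by
      obtain ⟨h1, h2, h3, -⟩ := hfast
      rw [traceRight, if_neg (by linarith), if_pos h3]
    rw [h1Plus, if_pos hfast, e]
    exact halfCell_fastShock hf hc hk hlip hγ hfast
  rw [h1Plus, if_neg hfast]
  by_cases h : α ≤ β
  · rw [traceRight, if_pos h]
    exact halfCell_rarefaction hf hc hk hlip hγ h
  push Not at h
  by_cases h3 : f β < f α
  · rw [traceRight, if_neg (by linarith), if_pos h3]
    exact halfCell_shock hf hc hk hlip hγ h h3 hfast
  rw [traceRight, if_neg (by linarith), if_neg h3]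
  obtain ⟨hγ1, hγ2⟩ := abs_le.1 hγ
  have e : fTilde f a γ β = f β := by
    unfold fTilde
    rw [if_neg (by linarith)]
    split_ifs with h1
    · rfl
    · rw [show γ + a = β by linarith]; ring
  rw [e]
  simp only [sub_self, mul_zero, add_zero]
  exact ⟨right_mem_uIcc, by simp, hγ, by simp⟩

theorem halfCell_left {f : ℝ → ℝ} (hf : Continuous f) (hc : StrictConvexOn ℝ univ f)
    {a k α β γ : ℝ} (ha : 0 < a) (hk : 0 < k)
    (hlip : ∀ x ∈ uIcc α β, ∀ y ∈ uIcc α β, k * |f x - f y| ≤ |x - y|) (hγ : |α - γ| ≤ a) :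
    HalfCell a β α γ (α - k * (h1Minus f a α β γ - f α)) (γ - k * h2Minus f a α β γ)
      (k * (entropyFlux f α - entropyFlux f (traceLeft f α β))) := by
  have hmem : ∀ x ∈ uIcc (-β) (-α), -x ∈ uIcc α β := by
    intro x hx
    rw [uIcc_comm] at hx
    rcases mem_uIcc.1 hx with ⟨h1, h2⟩ | ⟨h1, h2⟩
    · exact mem_uIcc.2 (Or.inr ⟨by linarith, by linarith⟩)
    · exact mem_uIcc.2 (Or.inl ⟨by linarith, by linarith⟩)
  obtain ⟨h1, h2, h3, h4⟩ := halfCell_right (f := fun x => f (-x)) (hf.comp continuous_neg)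
    (strictConvexOn_comp_neg hc) (a := a) (α := -β) (β := -α) (γ := -γ) hk
    (fun x hx y hy => by
      have := hlip _ (hmem x hx) _ (hmem y hy)
      rwa [neg_sub_neg, abs_sub_comm y x] at this)
    (by rwa [neg_sub_neg, abs_sub_comm])
  rw [h1Plus_comp_neg hf hc ha, h2Plus_comp_neg hf hc ha, traceRight_comp_neg hf hc,
    entropyFlux_neg, entropyFlux_neg] at *
  simp only [neg_neg] at h1 h3 h4
  obtain ⟨U, hU⟩ : ∃ U, U = α - k * (h1Minus f a α β γ - f α) := ⟨_, rfl⟩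
  obtain ⟨W, hW⟩ : ∃ W, W = γ - k * h2Minus f a α β γ := ⟨_, rfl⟩
  rw [show -α + k * (h1Minus f a α β γ - f α) = -U by rw [hU]; ring] at h1 h3 h4
  rw [show -γ + k * h2Minus f a α β γ = -W by rw [hW]; ring] at h2 h3 h4
  rw [neg_sub_neg, abs_sub_comm] at h2 h3
  rw [neg_sub_neg, abs_sub_comm] at h4
  rw [← hU, ← hW]
  refine ⟨?_, ?_, h3, ?_⟩
  · have := hmem _ h1
    rwa [neg_neg, uIcc_comm] at this
  · rwa [neg_sub_neg, abs_sub_comm α] at h2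
  · rw [neg_sq, neg_sq, neg_sq, neg_sq] at h4
    linarith

/-! ### One time step in one cell -/

theorem sub_mem_abs_le {m M α β U : ℝ} (hα : α ∈ Icc m M) (hβ : β ∈ Icc m M) (hU : U ∈ uIcc α β) :
    U ∈ Icc m M ∧ |U - β| ≤ |α - β| := by
  rw [mem_uIcc] at hU
  rcases hU with ⟨h1, h2⟩ | ⟨h1, h2⟩
  · refine ⟨⟨hα.1.trans h1, h2.trans hβ.2⟩, ?_⟩
    rw [abs_sub_comm, abs_sub_comm α, abs_of_nonneg (by linarith), abs_of_nonneg (by linarith)]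
    linarith
  · refine ⟨⟨hβ.1.trans h1, h2.trans hα.2⟩, ?_⟩
    rw [abs_of_nonneg (by linarith), abs_of_nonneg (by linarith)]
    linarith

/-- What one time step does to the state `(β, γ)` of a cell with neighbours `α` and `δ`. -/
structure CellStep (f : ℝ → ℝ) (a l m M α β δ γ u w : ℝ) : Prop where
  mem : u ∈ Icc m M
  sub_left : |u - β| ≤ |α - β| + |δ - β|
  sub_right : |w - γ| ≤ |α - β| + |δ - β|
  strip : |u - w| ≤ a
  dissipation : (u ^ 2 - β ^ 2) / 2 + (w ^ 2 - γ ^ 2) / 2 + a * |w - γ|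
    ≤ l * (entropyFlux f (traceLeft f α β) - entropyFlux f (traceLeft f β δ))

theorem cellStep {f : ℝ → ℝ} (hf : Continuous f) (hc : StrictConvexOn ℝ univ f)
    {a l m M α β δ γ : ℝ} (ha : 0 < a) (hl : 0 < l)
    (hlip : ∀ x ∈ Icc m M, ∀ y ∈ Icc m M, 2 * l * |f x - f y| ≤ |x - y|)
    (hα : α ∈ Icc m M) (hβ : β ∈ Icc m M) (hδ : δ ∈ Icc m M) (hγ : |β - γ| ≤ a) :
    CellStep f a l m M α β δ γ (β - l * (h1Minus f a β δ γ - h1Plus f a α β γ))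
      (γ - l * (h2Minus f a β δ γ - h2Plus f a α β γ)) := by
  have hsub : ∀ {x y}, x ∈ Icc m M → y ∈ Icc m M → uIcc x y ⊆ Icc m M := fun hx hy =>
    (convex_Icc m M).ordConnected.uIcc_subset hx hy
  have hk : 0 < 2 * l := by linarith
  obtain ⟨r1, r2, r3, r4⟩ := halfCell_right hf hc (a := a) hk
    (fun x hx y hy => hlip x (hsub hα hβ hx) y (hsub hα hβ hy)) hγ
  obtain ⟨s1, s2, s3, s4⟩ := halfCell_left hf hc ha hk
    (fun x hx y hy => hlip x (hsub hβ hδ hx) y (hsub hβ hδ hy)) hγ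
  have hq := mul_le_mul_of_nonneg_left (entropyFlux_traceRight_le hf hc.convexOn α β) hk.le
  obtain ⟨U, hU⟩ : ∃ U, U = β + 2 * l * (h1Plus f a α β γ - f β) := ⟨_, rfl⟩
  obtain ⟨V, hV⟩ : ∃ V, V = β - 2 * l * (h1Minus f a β δ γ - f β) := ⟨_, rfl⟩
  obtain ⟨W, hW⟩ : ∃ W, W = γ + 2 * l * h2Plus f a α β γ := ⟨_, rfl⟩
  obtain ⟨Z, hZ⟩ : ∃ Z, Z = γ - 2 * l * h2Minus f a β δ γ := ⟨_, rfl⟩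
  rw [← hU] at r1 r3 r4
  rw [← hV] at s1 s3 s4
  rw [← hW] at r2 r3 r4
  rw [← hZ] at s2 s3 s4
  -- The terms `f β` inserted in the two half-cell values cancel in their mean.
  have eu : β - l * (h1Minus f a β δ γ - h1Plus f a α β γ) = (U + V) / 2 := by
    rw [hU, hV]; ring
  have ew : γ - l * (h2Minus f a β δ γ - h2Plus f a α β γ) = (W + Z) / 2 := by
    rw [hW, hZ]; ring
  rw [eu, ew]
  obtain ⟨r5, r6⟩ := sub_mem_abs_le hα hβ r1
  obtain ⟨s5, s6⟩ := sub_mem_abs_le hδ hβ s1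
  have half : ∀ x y z p q : ℝ, |x - z| ≤ p → |y - z| ≤ q → |(x + y) / 2 - z| ≤ (p + q) / 2 := by
    intro x y z p q h1 h2
    rw [abs_le] at *
    constructor <;> linarith
  refine ⟨⟨by linarith [r5.1, s5.1], by linarith [r5.2, s5.2]⟩, ?_, ?_, ?_, ?_⟩
  · linarith [half _ _ _ _ _ r6 s6, abs_nonneg (α - β), abs_nonneg (δ - β)]
  · linarith [half _ _ _ _ _ r2 s2, abs_nonneg (α - β), abs_nonneg (δ - β)]
  · rw [abs_le] at r3 s3 ⊢
    constructor <;> linarith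
  · have h := mul_le_mul_of_nonneg_left (half _ _ _ _ _ le_rfl le_rfl : |(W + Z) / 2 - γ| ≤ _) ha.le
    -- The squares are the convexity defects of the two means; `hq` replaces the right trace by the
    -- left one, so that fluxes of adjacent cells match.
    linarith [sq_nonneg (U - V), sq_nonneg (W - Z)]

/-! ### Summation over the cells and the time steps -/

/-- The states for which the scheme is stable. -/
structure Admissible (a m M : ℝ) (s : ℤ → ℝ × ℝ) : Prop where
  summable_fst : Summable fun i => |(s i).1|
  summable_snd : Summable fun i => |(s i).2|
  mem : ∀ i, (s i).1 ∈ Icc m M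
  strip : ∀ i, |(s i).1 - (s i).2| ≤ a

theorem summable_sq_of_summable_abs {ι : Type*} {c : ι → ℝ} (h : Summable fun i => |c i|) :
    Summable fun i => c i ^ 2 := by
  have h1 : Tendsto (fun i => |c i|) cofinite (nhds 0) := h.tendsto_cofinite_zero
  refine Summable.of_norm_bounded_eventually h ?_
  filter_upwards [h1.eventually_le_const zero_lt_one] with i hi
  rw [Real.norm_eq_abs, abs_of_nonneg (sq_nonneg _), ← sq_abs]
  nlinarith [abs_nonneg (c i)]

/-- The sum over all cells of the energy `(u² + w²) / 2`. -/
def energy (s : ℤ → ℝ × ℝ) : ℝ := ∑' i, ((s i).1 ^ 2 / 2 + (s i).2 ^ 2 / 2)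

theorem Admissible.summable_energy {a m M : ℝ} {s : ℤ → ℝ × ℝ} (hs : Admissible a m M s) :
    Summable fun i => (s i).1 ^ 2 / 2 + (s i).2 ^ 2 / 2 :=
  ((summable_sq_of_summable_abs hs.summable_fst).div_const 2).add
    ((summable_sq_of_summable_abs hs.summable_snd).div_const 2)

/-- On bounded sets `q` is at most linear near its value at zero, which carries summability from the
states to the interface fluxes. -/
theorem abs_entropyFlux_sub_zero_le {f : ℝ → ℝ} (hf : Continuous f) (R : ℝ) :
    ∃ C, ∀ x, |x| ≤ R → |entropyFlux f x - entropyFlux f 0| ≤ C * |x| := by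
  obtain ⟨B, hB⟩ := (isCompact_Icc (a := -R) (b := R)).exists_bound_of_continuousOn hf.continuousOn
  refine ⟨B + B, fun x hx => ?_⟩
  have h1 : |∫ s in (0 : ℝ)..x, f s| ≤ B * |x - 0| := by
    refine intervalIntegral.norm_integral_le_of_norm_le_const fun s hs => hB s ?_
    have hs' : |s| ≤ |x| := by
      rcases mem_uIoc.1 hs with ⟨h1, h2⟩ | ⟨h1, h2⟩
      · rw [abs_of_pos h1]; exact h2.trans (le_abs_self x)
      · rw [abs_of_nonpos h2]; exact (neg_le_neg h1.le).trans (neg_le_abs x)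
    exact abs_le.1 (hs'.trans hx)
  have h2 : |f x| ≤ B := hB x (abs_le.1 hx)
  rw [entropyFlux_sub hf, zero_mul, sub_zero]
  calc |x * f x - ∫ s in (0 : ℝ)..x, f s| ≤ |x * f x| + |∫ s in (0 : ℝ)..x, f s| := abs_sub _ _
    _ ≤ (B + B) * |x| := by
        rw [abs_mul]
        rw [sub_zero] at h1
        nlinarith [abs_nonneg x]

theorem summable_shift {c : ℤ → ℝ} (h : Summable c) (j : ℤ) : Summable fun i => c (i + j) :=
  (Equiv.addRight j).summable_iff.2 h

theorem hasSum_sub_shift {c : ℤ → ℝ} {z : ℝ} (h : Summable fun i => c i - z) :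
    HasSum (fun i => c i - c (i + 1)) 0 := by
  have h1 := h.hasSum.sub ((Equiv.addRight (1 : ℤ)).hasSum_iff.2 h.hasSum)
  simpa using h1

theorem summable_entropyFlux_traceLeft {f : ℝ → ℝ} (hf : Continuous f)
    (hc : StrictConvexOn ℝ univ f) {c : ℤ → ℝ} (h : Summable fun i => |c i|) :
    Summable fun i => entropyFlux f (traceLeft f (c (i - 1)) (c i)) - entropyFlux f 0 := by
  have hsum : Summable fun i => |c (i - 1)| + |c i| := (summable_shift h (-1)).add h
  -- The whole sum serves as a bound for every single trace.
  obtain ⟨C, hC⟩ := abs_entropyFlux_sub_zero_le hf (∑' i, (|c (i - 1)| + |c i|))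
  have htr : ∀ i, |traceLeft f (c (i - 1)) (c i)| ≤ |c (i - 1)| + |c i| := by
    intro i
    have h1 := traceLeft_mem hf hc (c (i - 1)) (c i)
    rcases mem_uIcc.1 h1 with ⟨h2, h3⟩ | ⟨h2, h3⟩ <;> rw [abs_le] <;> constructor <;>
      linarith [neg_abs_le (c i), le_abs_self (c i), neg_abs_le (c (i - 1)),
        le_abs_self (c (i - 1)), abs_nonneg (c i), abs_nonneg (c (i - 1))]
  refine Summable.of_norm_bounded (hsum.mul_left |C|) fun i => ?_
  have h0 : |traceLeft f (c (i - 1)) (c i)| ≤ ∑' i, (|c (i - 1)| + |c i|) :=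
    (htr i).trans (hsum.le_tsum i fun j _ => by positivity)
  refine (hC _ h0).trans ?_
  exact (mul_le_mul_of_nonneg_right (le_abs_self C) (abs_nonneg _)).trans
    (mul_le_mul_of_nonneg_left (htr i) (abs_nonneg C))

/-- One time step keeps the states admissible and dissipates the energy. -/
theorem Admissible.step {f : ℝ → ℝ} (hf : Continuous f) (hc : StrictConvexOn ℝ univ f)
    {a l m M : ℝ} {s r : ℤ → ℝ × ℝ} (hs : Admissible a m M s)
    (hr : ∀ i, CellStep f a l m M (s (i - 1)).1 (s i).1 (s (i + 1)).1 (s i).2 (r i).1 (r i).2) :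
    Admissible a m M r ∧ Summable (fun i => |(r i).2 - (s i).2|) ∧
      energy r + a * ∑' i, |(r i).2 - (s i).2| ≤ energy s := by
  -- Increments are controlled by differences of neighbours. Summability thus passes to the next
  -- step; no bound uniform in time is needed.
  have hd : Summable fun i => |(s (i - 1)).1 - (s i).1| + |(s (i + 1)).1 - (s i).1| := by
    have h1 := hs.summable_fst
    refine Summable.of_nonneg_of_le (fun i => by positivity) (fun i => ?_)
      (((summable_shift h1 (-1)).add h1).add ((summable_shift h1 1).add h1))
    exact add_le_add (abs_sub _ _) (abs_sub _ _)
  have hdw : Summable fun i => |(r i).2 - (s i).2| :=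
    Summable.of_nonneg_of_le (fun i => abs_nonneg _) (fun i => (hr i).sub_right) hd
  have hdu : Summable fun i => |(r i).1 - (s i).1| :=
    Summable.of_nonneg_of_le (fun i => abs_nonneg _) (fun i => (hr i).sub_left) hd
  have hadm : Admissible a m M r := by
    refine ⟨?_, ?_, fun i => (hr i).mem, fun i => (hr i).strip⟩
    · refine Summable.of_nonneg_of_le (fun i => abs_nonneg _) (fun i => ?_)
        (hdu.add hs.summable_fst)
      simpa using abs_add_le ((r i).1 - (s i).1) (s i).1
    · refine Summable.of_nonneg_of_le (fun i => abs_nonneg _) (fun i => ?_)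
        (hdw.add hs.summable_snd)
      simpa using abs_add_le ((r i).2 - (s i).2) (s i).2
  refine ⟨hadm, hdw, ?_⟩
  have hflux := (hasSum_sub_shift (summable_entropyFlux_traceLeft hf hc hs.summable_fst)).mul_left l
  have hlhs := (hadm.summable_energy.hasSum.sub hs.summable_energy.hasSum).add
    (hdw.hasSum.mul_left a)
  have := hasSum_le (fun i => ?_) hlhs hflux
  · unfold energy
    linarith
  · have h := (hr i).dissipation
    rw [add_sub_cancel_right]
    linarith

theorem scheme_admissible {f : ℝ → ℝ} (hf : Continuous f) (hc : StrictConvexOn ℝ univ f)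
    {a x₀ dx dt m M : ℝ} {u₀ w₀ : ℝ → ℝ} (ha : 0 < a) (hl : 0 < dt / dx)
    (hlip : ∀ x ∈ Icc m M, ∀ y ∈ Icc m M, 2 * (dt / dx) * |f x - f y| ≤ |x - y|)
    (h0 : Admissible a m M (scheme f a x₀ dx dt u₀ w₀ 0)) (n : ℕ) :
    Admissible a m M (scheme f a x₀ dx dt u₀ w₀ n) := by
  induction n with
  | zero => exact h0
  | succ n ih =>
    exact (ih.step hf hc fun i =>
      cellStep hf hc ha hl hlip (ih.mem _) (ih.mem i) (ih.mem _) (ih.strip i)).1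

theorem scheme_energy_step {f : ℝ → ℝ} (hf : Continuous f) (hc : StrictConvexOn ℝ univ f)
    {a x₀ dx dt m M : ℝ} {u₀ w₀ : ℝ → ℝ} (ha : 0 < a) (hl : 0 < dt / dx)
    (hlip : ∀ x ∈ Icc m M, ∀ y ∈ Icc m M, 2 * (dt / dx) * |f x - f y| ≤ |x - y|)
    (h0 : Admissible a m M (scheme f a x₀ dx dt u₀ w₀ 0)) (n : ℕ) :
    Summable (fun i => |(scheme f a x₀ dx dt u₀ w₀ (n + 1) i).2
      - (scheme f a x₀ dx dt u₀ w₀ n i).2|) ∧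
    energy (scheme f a x₀ dx dt u₀ w₀ (n + 1))
      + a * ∑' i, |(scheme f a x₀ dx dt u₀ w₀ (n + 1) i).2 - (scheme f a x₀ dx dt u₀ w₀ n i).2|
      ≤ energy (scheme f a x₀ dx dt u₀ w₀ n) := by
  have ih := scheme_admissible hf hc ha hl hlip h0 n
  exact (ih.step hf hc fun i =>
    cellStep hf hc ha hl hlip (ih.mem _) (ih.mem i) (ih.mem _) (ih.strip i)).2

theorem scheme_energy_le {f : ℝ → ℝ} (hf : Continuous f) (hc : StrictConvexOn ℝ univ f)
    {a x₀ dx dt m M : ℝ} {u₀ w₀ : ℝ → ℝ} (ha : 0 < a) (hl : 0 < dt / dx)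
    (hlip : ∀ x ∈ Icc m M, ∀ y ∈ Icc m M, 2 * (dt / dx) * |f x - f y| ≤ |x - y|)
    (h0 : Admissible a m M (scheme f a x₀ dx dt u₀ w₀ 0)) (n : ℕ) :
    energy (scheme f a x₀ dx dt u₀ w₀ n)
      + a * ∑ j ∈ Finset.range n, ∑' i, |(scheme f a x₀ dx dt u₀ w₀ (j + 1) i).2
        - (scheme f a x₀ dx dt u₀ w₀ j i).2|
      ≤ energy (scheme f a x₀ dx dt u₀ w₀ 0) := by
  induction n with
  | zero => simp
  | succ n ih =>
    rw [Finset.sum_range_succ, mul_add]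
    linarith [(scheme_energy_step hf hc ha hl hlip h0 n).2]

/-! ### CFL condition, cell means and initial data -/

/-- The CFL condition bounds the speeds of all waves. -/
theorem lipschitz_of_CFL {f u₀ : ℝ → ℝ} (hf : ContDiff ℝ 1 f) {dx dt : ℝ} (hdx : 0 < dx)
    (hdt : 0 < dt) (hCFL : CFL f u₀ dx dt) :
    ∀ x ∈ Icc (essInf u₀ volume) (essSup u₀ volume),
      ∀ y ∈ Icc (essInf u₀ volume) (essSup u₀ volume),
      2 * (dt / dx) * |f x - f y| ≤ |x - y| := by
  intro x hx y hy
  have hbdd : BddAbove ((fun v => |deriv f v|) '' Icc (essInf u₀ volume) (essSup u₀ volume)) :=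
    isCompact_Icc.bddAbove_image (hf.continuous_deriv le_rfl).abs.continuousOn
  have h1 := (convex_Icc (essInf u₀ volume) (essSup u₀ volume)).norm_image_sub_le_of_norm_deriv_le
    (f := f) (C := maxSpeed f u₀) (fun v _ => hf.differentiable one_ne_zero v)
    (fun v hv => le_csSup hbdd (mem_image_of_mem _ hv)) hy hx
  rw [Real.norm_eq_abs, Real.norm_eq_abs] at h1
  have h2 : 2 * (dt / dx) * maxSpeed f u₀ ≤ 1 := by
    rw [show 2 * (dt / dx) * maxSpeed f u₀ = dt * (2 * maxSpeed f u₀) / dx by ring]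
    exact (div_le_one hdx).2 hCFL
  calc 2 * (dt / dx) * |f x - f y| ≤ 2 * (dt / dx) * (maxSpeed f u₀ * |x - y|) :=
        mul_le_mul_of_nonneg_left h1 (by positivity)
    _ = 2 * (dt / dx) * maxSpeed f u₀ * |x - y| := by ring
    _ ≤ |x - y| := mul_le_of_le_one_left (abs_nonneg _) h2

theorem floor_preimage_singleton (x₀ : ℝ) {dx : ℝ} (hdx : 0 < dx) (i : ℤ) :
    (fun x : ℝ => ⌊(x - x₀) / dx⌋) ⁻¹' {i} = Ico (x₀ + i * dx) (x₀ + (i + 1) * dx) := by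
  ext x
  rw [mem_preimage, mem_singleton_iff, Int.floor_eq_iff, le_div_iff₀ hdx, div_lt_iff₀ hdx, mem_Ico]
  constructor <;> rintro ⟨h1, h2⟩ <;> constructor <;> linarith

theorem volume_cell (x₀ : ℝ) (dx : ℝ) (i : ℤ) :
    volume (Ico (x₀ + i * dx) (x₀ + (i + 1) * dx)) = ENNReal.ofReal dx := by
  rw [Real.volume_Ico]
  congr 1
  ring

theorem measurable_cellIndex (x₀ dx : ℝ) : Measurable fun x : ℝ => ⌊(x - x₀) / dx⌋ :=
  Int.measurable_floor.comp ((measurable_id.sub_const _).div_const _)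

/-- Through this push-forward, integrability of a function constant on cells becomes summability of
its values. -/
theorem map_cellIndex (x₀ : ℝ) {dx : ℝ} (hdx : 0 < dx) :
    (volume : Measure ℝ).map (fun x : ℝ => ⌊(x - x₀) / dx⌋) = ENNReal.ofReal dx • Measure.count := by
  refine Measure.ext_of_singleton fun i => ?_
  rw [Measure.map_apply (measurable_cellIndex x₀ dx) (measurableSet_singleton i),
    floor_preimage_singleton x₀ hdx, volume_cell, Measure.smul_apply, Measure.count_singleton,
    smul_eq_mul, mul_one]

theorem integrable_cells (x₀ : ℝ) {dx : ℝ} (hdx : 0 < dx) {c : ℤ → ℝ}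
    (hc : Summable fun i => |c i|) : Integrable fun x : ℝ => c ⌊(x - x₀) / dx⌋ := by
  have h0 : Integrable c Measure.count := integrable_count_iff.2 hc
  have h : Integrable c ((volume : Measure ℝ).map (fun x : ℝ => ⌊(x - x₀) / dx⌋)) := by
    rw [map_cellIndex x₀ hdx]
    exact h0.smul_measure ENNReal.ofReal_ne_top
  exact h.comp_measurable (measurable_cellIndex x₀ dx)

theorem hasSum_integral_cells (x₀ : ℝ) {dx : ℝ} (hdx : 0 < dx) {v : ℝ → ℝ} (hv : Integrable v) :
    HasSum (fun i : ℤ => ∫ x in Ico (x₀ + i * dx) (x₀ + (i + 1) * dx), v x) (∫ x, v x) := by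
  have h := hasSum_integral_iUnion (μ := volume) (f := v)
    (s := fun i : ℤ => (fun x : ℝ => ⌊(x - x₀) / dx⌋) ⁻¹' {i})
    (fun i => measurable_cellIndex x₀ dx (measurableSet_singleton i))
    (fun i j hij => Disjoint.preimage _ (by simpa using hij)) hv.integrableOn
  simp only [floor_preimage_singleton x₀ hdx] at h
  rwa [← setIntegral_univ (f := v), show (univ : Set ℝ) = ⋃ i : ℤ,
    Ico (x₀ + i * dx) (x₀ + (i + 1) * dx) from ?_]
  symm
  rw [eq_univ_iff_forall]
  intro x
  rw [mem_iUnion]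
  refine ⟨⌊(x - x₀) / dx⌋, ?_⟩
  rw [← floor_preimage_singleton x₀ hdx]
  rfl

theorem integral_cells (x₀ : ℝ) {dx : ℝ} (hdx : 0 < dx) {c : ℤ → ℝ}
    (hc : Summable fun i => |c i|) : ∫ x : ℝ, c ⌊(x - x₀) / dx⌋ = dx * ∑' i, c i := by
  rw [← (hasSum_integral_cells x₀ hdx (integrable_cells x₀ hdx hc)).tsum_eq, ← tsum_mul_left]
  congr 1
  ext i
  rw [setIntegral_congr_fun (g := fun _ => c i) measurableSet_Ico, setIntegral_const,
    measureReal_def, volume_cell, ENNReal.toReal_ofReal hdx.le, smul_eq_mul]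
  intro x hx
  rw [← floor_preimage_singleton x₀ hdx] at hx
  exact congrArg c hx

theorem cellMean_mul (x₀ : ℝ) {dx : ℝ} (hdx : 0 < dx) (v : ℝ → ℝ) (i : ℤ) :
    dx * cellMean x₀ dx v i = ∫ x in Ico (x₀ + i * dx) (x₀ + (i + 1) * dx), v x := by
  unfold cellMean
  field_simp

theorem setIntegral_cell_const (x₀ : ℝ) {dx : ℝ} (hdx : 0 < dx) (i : ℤ) (b : ℝ) :
    ∫ _ in Ico (x₀ + i * dx) (x₀ + (i + 1) * dx), b = dx * b := by
  rw [setIntegral_const, measureReal_def, volume_cell, ENNReal.toReal_ofReal hdx.le, smul_eq_mul]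

theorem integrableOn_cell_const (x₀ dx : ℝ) (i : ℤ) (b : ℝ) :
    IntegrableOn (fun _ : ℝ => b) (Ico (x₀ + i * dx) (x₀ + (i + 1) * dx)) :=
  integrableOn_const (by rw [volume_cell]; exact ENNReal.ofReal_ne_top)

theorem cellMean_mem_Icc (x₀ : ℝ) {dx : ℝ} (hdx : 0 < dx) {v : ℝ → ℝ} (hv : Integrable v)
    {m M : ℝ} (h : ∀ᵐ x, v x ∈ Icc m M) (i : ℤ) : cellMean x₀ dx v i ∈ Icc m M := by
  constructor <;> refine le_of_mul_le_mul_left ?_ hdx <;> rw [cellMean_mul x₀ hdx]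
  · rw [← setIntegral_cell_const x₀ hdx i m]
    exact setIntegral_mono_ae (integrableOn_cell_const x₀ dx i m) hv.integrableOn
      (h.mono fun x hx => hx.1)
  · rw [← setIntegral_cell_const x₀ hdx i M]
    exact setIntegral_mono_ae hv.integrableOn (integrableOn_cell_const x₀ dx i M)
      (h.mono fun x hx => hx.2)

theorem cellMean_sub (x₀ dx : ℝ) {u w : ℝ → ℝ} (hu : Integrable u) (hw : Integrable w) (i : ℤ) :
    cellMean x₀ dx (fun x => u x - w x) i = cellMean x₀ dx u i - cellMean x₀ dx w i := by
  unfold cellMean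
  rw [integral_sub hu.integrableOn hw.integrableOn, mul_sub]

theorem summable_cellMean (x₀ : ℝ) {dx : ℝ} (hdx : 0 < dx) {v : ℝ → ℝ} (hv : Integrable v) :
    Summable fun i => |cellMean x₀ dx v i| := by
  refine Summable.of_nonneg_of_le (fun i => abs_nonneg _) (fun i => ?_)
    ((hasSum_integral_cells x₀ hdx hv.abs).summable.mul_left (1 / dx))
  rw [cellMean, abs_mul, abs_of_pos (by positivity : 0 < 1 / dx)]
  exact mul_le_mul_of_nonneg_left (abs_integral_le_integral_abs) (by positivity)

/-- Averaging over the cells does not increase the `L²` norm. -/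
theorem tsum_cellMean_sq_le (x₀ : ℝ) {dx : ℝ} (hdx : 0 < dx) {v : ℝ → ℝ} (hv : Integrable v)
    (hv2 : Integrable fun x => v x ^ 2) :
    dx * ∑' i, cellMean x₀ dx v i ^ 2 ≤ ∫ x, v x ^ 2 := by
  have hs := (summable_sq_of_summable_abs (summable_cellMean x₀ hdx hv)).hasSum.mul_left dx
  refine hasSum_le (fun i => ?_) hs (hasSum_integral_cells x₀ hdx hv2)
  obtain ⟨b, hb⟩ : ∃ b, b = cellMean x₀ dx v i := ⟨_, rfl⟩
  rw [← hb]
  -- Jensen's inequality on the cell: the integrand is `(v - b)²` with `b` the mean.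
  have h0 : 0 ≤ ∫ x in Ico (x₀ + i * dx) (x₀ + (i + 1) * dx), (v x ^ 2 - 2 * b * v x + b ^ 2) :=
    integral_nonneg fun x => by
      change 0 ≤ v x ^ 2 - 2 * b * v x + b ^ 2
      nlinarith [sq_nonneg (v x - b)]
  have hv2' := hv2.integrableOn (s := Ico (x₀ + i * dx) (x₀ + (i + 1) * dx))
  have hv' : IntegrableOn (fun x => 2 * b * v x) (Ico (x₀ + i * dx) (x₀ + (i + 1) * dx)) :=
    (hv.const_mul (2 * b)).integrableOn
  have hd : IntegrableOn (fun x => v x ^ 2 - 2 * b * v x)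
      (Ico (x₀ + i * dx) (x₀ + (i + 1) * dx)) := hv2'.sub hv'
  rw [integral_add hd (integrableOn_cell_const x₀ dx i _), integral_sub hv2' hv', integral_const_mul, setIntegral_cell_const x₀ hdx,
      ← cellMean_mul x₀ hdx v, ← hb] at h0
  linarith

/-- Bounded variation serves only to give essential boundedness, which makes the real-valued
`essInf` and `essSup` meaningful and the squares of the data integrable. -/
theorem IsBV.exists_bound {v : ℝ → ℝ} (hv : IsBV v) : ∃ B, ∀ᵐ x, |v x| ≤ B := by
  obtain ⟨g, hg, hbv⟩ := hv
  refine ⟨|g 0| + (eVariationOn g univ).toReal, hg.mono fun x hx => ?_⟩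
  have h := hbv.dist_le (mem_univ x) (mem_univ 0)
  rw [Real.dist_eq] at h
  rw [hx]
  have := abs_add_le (g x - g 0) (g 0)
  rw [sub_add_cancel] at this
  linarith

theorem ae_mem_Icc_essInf_essSup {v : ℝ → ℝ} {B : ℝ} (hB : ∀ᵐ x, |v x| ≤ B) :
    ∀ᵐ x, v x ∈ Icc (essInf v volume) (essSup v volume) := by
  have h1 : IsBoundedUnder (· ≤ ·) (ae volume) v :=
    isBoundedUnder_of_eventually_le (hB.mono fun x hx => (abs_le.1 hx).2)
  have h2 : IsBoundedUnder (· ≥ ·) (ae volume) v :=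
    isBoundedUnder_of_eventually_ge (hB.mono fun x hx => (abs_le.1 hx).1)
  filter_upwards [ae_le_essSup h1, ae_essInf_le h2] with x hx1 hx2
  exact ⟨hx2, hx1⟩

theorem integrable_sq_of_bounded {v : ℝ → ℝ} (hv : Integrable v) {B : ℝ} (hB : ∀ᵐ x, |v x| ≤ B) :
    Integrable fun x => v x ^ 2 := by
  simp_rw [pow_two]
  exact hv.bdd_mul hv.aestronglyMeasurable hB

theorem admissible_zero (f : ℝ → ℝ) {a : ℝ} (x₀ : ℝ) {dx : ℝ} (dt : ℝ) (hdx : 0 < dx)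
    {u₀ w₀ : ℝ → ℝ} (hu₀ : Integrable u₀) (hw₀ : Integrable w₀) {B : ℝ} (hB : ∀ᵐ x, |u₀ x| ≤ B)
    (hstrip : ∀ᵐ x : ℝ, |u₀ x - w₀ x| ≤ a) :
    Admissible a (essInf u₀ volume) (essSup u₀ volume) (scheme f a x₀ dx dt u₀ w₀ 0) where
  summable_fst := summable_cellMean x₀ hdx hu₀
  summable_snd := summable_cellMean x₀ hdx hw₀
  mem := cellMean_mem_Icc x₀ hdx hu₀ (ae_mem_Icc_essInf_essSup hB)
  strip i := by
    change |cellMean x₀ dx u₀ i - cellMean x₀ dx w₀ i| ≤ a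
    rw [← cellMean_sub x₀ dx hu₀ hw₀, abs_le]
    exact cellMean_mem_Icc x₀ hdx (hu₀.sub hw₀) (hstrip.mono fun x hx => abs_le.1 hx) i

theorem energy_zero_le (f : ℝ → ℝ) (a x₀ : ℝ) {dx : ℝ} (dt : ℝ) (hdx : 0 < dx)
    {u₀ w₀ : ℝ → ℝ} (hu₀ : Integrable u₀) (hw₀ : Integrable w₀)
    (hu2 : Integrable fun x => u₀ x ^ 2) (hw2 : Integrable fun x => w₀ x ^ 2) :
    dx * energy (scheme f a x₀ dx dt u₀ w₀ 0)
      ≤ (1 / 2) * (∫ x, u₀ x ^ 2) + (1 / 2) * ∫ x, w₀ x ^ 2 := by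
  have h1 := tsum_cellMean_sq_le x₀ hdx hu₀ hu2
  have h2 := tsum_cellMean_sq_le x₀ hdx hw₀ hw2
  have h : energy (scheme f a x₀ dx dt u₀ w₀ 0)
      = (∑' i, cellMean x₀ dx u₀ i ^ 2) / 2 + (∑' i, cellMean x₀ dx w₀ i ^ 2) / 2 := by
    rw [← tsum_div_const, ← tsum_div_const]
    exact ((summable_sq_of_summable_abs (summable_cellMean x₀ hdx hu₀)).div_const 2).tsum_add
      ((summable_sq_of_summable_abs (summable_cellMean x₀ hdx hw₀)).div_const 2)
  rw [h]
  linarith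

/-! ### The time derivative of a step function as a measure -/

/-- The function of `(x, t)` with the value `W n i` on the `i`-th cell in the `n`-th time step. -/
def stepFun (x₀ dx dt : ℝ) (W : ℕ → ℤ → ℝ) (x t : ℝ) : ℝ := W ⌊t / dt⌋₊ ⌊(x - x₀) / dx⌋

/-- The jump in time of `stepFun` at the discrete times. -/
def jumpDensity (x₀ dx dt : ℝ) (W : ℕ → ℤ → ℝ) (z : ℝ × ℝ) : ℝ :=
  W ⌊z.2 / dt⌋₊ ⌊(z.1 - x₀) / dx⌋ - W (⌊z.2 / dt⌋₊ - 1) ⌊(z.1 - x₀) / dx⌋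

/-- The length measure on the lines `t = dt, …, t = N dt`. -/
def discreteTimes (dt : ℝ) (N : ℕ) : Measure (ℝ × ℝ) :=
  ∑ n ∈ Finset.range N, (volume : Measure ℝ).map fun x => (x, ((n : ℝ) + 1) * dt)

theorem measurable_prodMk_const (c : ℝ) : Measurable fun x : ℝ => (x, c) :=
  measurable_id.prodMk measurable_const

theorem measurable_jumpDensity (x₀ dx dt : ℝ) (W : ℕ → ℤ → ℝ) :
    Measurable (jumpDensity x₀ dx dt W) := by
  have h : Measurable fun z : ℝ × ℝ => (⌊z.2 / dt⌋₊, ⌊(z.1 - x₀) / dx⌋) :=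
    (Nat.measurable_floor.comp (measurable_snd.div_const dt)).prodMk
      ((measurable_cellIndex x₀ dx).comp measurable_fst)
  exact (Measurable.of_discrete (f := fun p : ℕ × ℤ => W p.1 p.2 - W (p.1 - 1) p.2)).comp h

/-- The discrete times start at `dt`, so the truncated subtraction in `jumpDensity` never acts on
index zero there. -/
theorem jumpDensity_succ (x₀ dx : ℝ) {dt : ℝ} (hdt : 0 < dt) (W : ℕ → ℤ → ℝ) (n : ℕ) (x : ℝ) :
    jumpDensity x₀ dx dt W (x, ((n : ℝ) + 1) * dt)
      = W (n + 1) ⌊(x - x₀) / dx⌋ - W n ⌊(x - x₀) / dx⌋ := by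
  have h : ⌊((n : ℝ) + 1) * dt / dt⌋₊ = n + 1 := by
    rw [mul_div_cancel_right₀ _ hdt.ne']
    exact_mod_cast Nat.floor_natCast (R := ℝ) (n + 1)
  unfold jumpDensity
  rw [h, Nat.add_sub_cancel]

theorem integrable_discreteTimes_iff {dt : ℝ} {N : ℕ} {g : ℝ × ℝ → ℝ} (hg : Measurable g) :
    Integrable g (discreteTimes dt N)
      ↔ ∀ n < N, Integrable fun x => g (x, ((n : ℝ) + 1) * dt) := by
  unfold discreteTimes
  rw [integrable_finsetSum_measure]
  simp only [Finset.mem_range]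
  refine forall₂_congr fun n _ => ?_
  rw [integrable_map_measure hg.aestronglyMeasurable (measurable_prodMk_const _).aemeasurable]
  rfl

theorem integral_discreteTimes {dt : ℝ} {N : ℕ} {g : ℝ × ℝ → ℝ} (hg : Measurable g)
    (hi : Integrable g (discreteTimes dt N)) :
    ∫ z, g z ∂discreteTimes dt N
      = ∑ n ∈ Finset.range N, ∫ x, g (x, ((n : ℝ) + 1) * dt) := by
  unfold discreteTimes at *
  rw [integral_finsetSum_measure (integrable_finsetSum_measure.1 hi)]
  refine Finset.sum_congr rfl fun n _ => ?_
  rw [integral_map (measurable_prodMk_const _).aemeasurable hg.aestronglyMeasurable]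

theorem integrable_jumpDensity (x₀ : ℝ) {dx dt : ℝ} (hdx : 0 < dx) (hdt : 0 < dt)
    {W : ℕ → ℤ → ℝ} (hW : ∀ n, Summable fun i => |W n i|) (N : ℕ) :
    Integrable (jumpDensity x₀ dx dt W) (discreteTimes dt N) := by
  rw [integrable_discreteTimes_iff (measurable_jumpDensity x₀ dx dt W)]
  intro n _
  simp only [jumpDensity_succ x₀ dx hdt]
  exact (integrable_cells x₀ hdx (hW (n + 1))).sub (integrable_cells x₀ hdx (hW n))

/-- The signed measure with density `J` with respect to `ρ`, by its Jordan decomposition. -/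
def jordanOfDensity {X : Type*} [MeasurableSpace X] (ρ : Measure X) (J : X → ℝ)
    (hJ : Measurable J) (hi : Integrable J ρ) : JordanDecomposition X where
  posPart := ρ.withDensity fun x => ENNReal.ofReal (J x)
  negPart := ρ.withDensity fun x => ENNReal.ofReal (-J x)
  posPart_finite := isFiniteMeasure_withDensity_ofReal hi.2
  negPart_finite := isFiniteMeasure_withDensity_ofReal hi.neg.2
  mutuallySingular := withDensity_ofReal_mutuallySingular hJ

theorem integral_jordanOfDensity {X : Type*} [MeasurableSpace X] {ρ : Measure X} {J : X → ℝ}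
    (hJ : Measurable J) (hi : Integrable J ρ) {φ : X → ℝ} (hφ : Measurable φ) {C : ℝ}
    (hC : ∀ x, |φ x| ≤ C) :
    ∫ x, φ x ∂(jordanOfDensity ρ J hJ hi).posPart - ∫ x, φ x ∂(jordanOfDensity ρ J hJ hi).negPart
      = ∫ x, φ x * J x ∂ρ := by
  change ∫ x, φ x ∂(ρ.withDensity fun x => ENNReal.ofReal (J x))
    - ∫ x, φ x ∂(ρ.withDensity fun x => ENNReal.ofReal (-J x)) = _
  rw [integral_withDensity_eq_integral_toReal_smul hJ.ennreal_ofReal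
      (ae_of_all _ fun x => ENNReal.ofReal_lt_top),
    integral_withDensity_eq_integral_toReal_smul (f := fun x => ENNReal.ofReal (-J x))
      hJ.neg.ennreal_ofReal
      (ae_of_all _ fun x => ENNReal.ofReal_lt_top)]
  simp only [ENNReal.toReal_ofReal', smul_eq_mul]
  have h1 : Integrable (fun x => max (J x) 0 * φ x) ρ := by
    simp_rw [mul_comm _ (φ _)]
    exact hi.pos_part.bdd_mul hφ.aestronglyMeasurable (ae_of_all _ hC)
  have h2 : Integrable (fun x => max (-J x) 0 * φ x) ρ := by
    simp_rw [mul_comm _ (φ _)]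
    exact hi.neg_part.bdd_mul hφ.aestronglyMeasurable (ae_of_all _ hC)
  rw [← integral_sub h1 h2]
  congr 1
  ext x
  rcases le_total 0 (J x) with h | h
  · rw [max_eq_left h, max_eq_right (by linarith)]; ring
  · rw [max_eq_right h, max_eq_left (by linarith)]; ring

theorem totalVariation_jordanOfDensity {X : Type*} [MeasurableSpace X] {ρ : Measure X} {J : X → ℝ}
    (hJ : Measurable J) (hi : Integrable J ρ) {A : Set X} (hA : MeasurableSet A) :
    (jordanOfDensity ρ J hJ hi).toSignedMeasure.totalVariation A
      = ∫⁻ x, A.indicator (fun x => ENNReal.ofReal |J x|) x ∂ρ := by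
  rw [SignedMeasure.totalVariation, JordanDecomposition.toJordanDecomposition_toSignedMeasure,
    lintegral_indicator hA, Measure.add_apply]
  change (ρ.withDensity fun x => ENNReal.ofReal (J x)) A
    + (ρ.withDensity fun x => ENNReal.ofReal (-J x)) A = _
  rw [withDensity_apply _ hA, withDensity_apply _ hA, ← lintegral_add_left hJ.ennreal_ofReal]
  congr 1
  ext x
  rcases le_total 0 (J x) with h | h
  · rw [ENNReal.ofReal_of_nonpos (neg_nonpos.2 h), add_zero, abs_of_nonneg h]
  · rw [ENNReal.ofReal_of_nonpos h, zero_add, abs_of_nonpos h]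

/-- The derivative in time of `stepFun` on `ℝ × (0, N dt)`. -/
def stepDerivative (x₀ : ℝ) {dx dt : ℝ} (hdx : 0 < dx) (hdt : 0 < dt) (W : ℕ → ℤ → ℝ)
    (hW : ∀ n, Summable fun i => |W n i|) (N : ℕ) : SignedMeasure (ℝ × ℝ) :=
  (jordanOfDensity (discreteTimes dt N) (jumpDensity x₀ dx dt W)
    (measurable_jumpDensity x₀ dx dt W) (integrable_jumpDensity x₀ hdx hdt hW N)).toSignedMeasure

theorem totalVariation_stepDerivative_le (x₀ : ℝ) {dx dt : ℝ} (hdx : 0 < dx) (hdt : 0 < dt)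
    (W : ℕ → ℤ → ℝ) (hW : ∀ n, Summable fun i => |W n i|) (N : ℕ) (t : ℝ) :
    ((stepDerivative x₀ hdx hdt W hW N).totalVariation (univ ×ˢ Ioo 0 t)).toReal
      ≤ dx * ∑ n ∈ Finset.range ⌊t / dt⌋₊, ∑' i, |W (n + 1) i - W n i| := by
  have hA : MeasurableSet ((univ : Set ℝ) ×ˢ Ioo 0 t) := MeasurableSet.univ.prod measurableSet_Ioo
  have hpos : ∀ n, 0 ≤ ∑' i, |W (n + 1) i - W n i| := fun n => tsum_nonneg fun i => abs_nonneg _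
  refine ENNReal.toReal_le_of_le_ofReal
    (mul_nonneg hdx.le (Finset.sum_nonneg fun n _ => hpos n)) ?_
  rw [stepDerivative, totalVariation_jordanOfDensity _ _ hA, discreteTimes,
    lintegral_finsetSum_measure, Finset.mul_sum,
    ENNReal.ofReal_sum_of_nonneg fun n _ => mul_nonneg hdx.le (hpos n)]
  have hmeas : Measurable (((univ : Set ℝ) ×ˢ Ioo 0 t).indicator
      fun z => ENNReal.ofReal |jumpDensity x₀ dx dt W z|) :=
    (measurable_jumpDensity x₀ dx dt W).abs.ennreal_ofReal.indicator hA
  have hterm : ∀ n ∈ Finset.range N, ∫⁻ z, ((univ : Set ℝ) ×ˢ Ioo 0 t).indicator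
      (fun z => ENNReal.ofReal |jumpDensity x₀ dx dt W z|) z
        ∂(volume : Measure ℝ).map (fun x => (x, ((n : ℝ) + 1) * dt))
      ≤ if n ∈ Finset.range ⌊t / dt⌋₊ then
        ENNReal.ofReal (dx * ∑' i, |W (n + 1) i - W n i|) else 0 := by
    intro n _
    rw [lintegral_map hmeas (measurable_prodMk_const _)]
    split_ifs with h
    · have hs : Summable fun i => |W (n + 1) i - W n i| :=
        Summable.of_nonneg_of_le (fun i => abs_nonneg _) (fun i => abs_sub _ _)
          ((hW (n + 1)).add (hW n))
      have hs' : Summable fun i => |(|W (n + 1) i - W n i|)| := by simpa only [abs_abs] using hs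
      rw [← integral_cells x₀ hdx hs', ofReal_integral_eq_lintegral_ofReal
        (integrable_cells x₀ hdx hs') (ae_of_all _ fun x => abs_nonneg _)]
      refine lintegral_mono fun x => (indicator_le_self _ _ _).trans ?_
      rw [jumpDensity_succ x₀ dx hdt]
    · refine le_of_eq (lintegral_eq_zero_of_ae_eq_zero (ae_of_all _ fun x => ?_))
      refine indicator_of_notMem (fun hx => h ?_) _
      have h2 : ((n : ℝ) + 1) * dt < t := hx.2.2
      rw [Finset.mem_range, ← Nat.succ_le_iff]
      -- A line `(n + 1) dt < t` has `n + 1 ≤ ⌊t / dt⌋₊`; every other line misses the strip.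
      refine Nat.le_floor ?_
      rw [le_div_iff₀ hdt]
      push_cast
      exact h2.le
  refine (Finset.sum_le_sum hterm).trans ?_
  rw [← Finset.sum_filter]
  exact Finset.sum_le_sum_of_subset fun n hn => (Finset.mem_filter.1 hn).2

theorem stepFun_eq_sum (x₀ dx : ℝ) {dt : ℝ} (hdt : 0 < dt) (W : ℕ → ℤ → ℝ) {N : ℕ} {x t : ℝ}
    (ht0 : 0 ≤ t) (htN : t < N * dt) :
    stepFun x₀ dx dt W x t = ∑ n ∈ Finset.range N,
      W n ⌊(x - x₀) / dx⌋ * (Ico (n * dt) ((n + 1) * dt)).indicator 1 t := by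
  have hfloor : ∀ n : ℕ, t ∈ Ico (n * dt) ((n + 1) * dt) ↔ ⌊t / dt⌋₊ = n := by
    intro n
    rw [Nat.floor_eq_iff (by positivity), le_div_iff₀ hdt, div_lt_iff₀ hdt, mem_Ico]
  rw [Finset.sum_eq_single ⌊t / dt⌋₊]
  · rw [indicator_of_mem ((hfloor _).2 rfl), Pi.one_apply, mul_one, stepFun]
  · intro n _ hn
    rw [indicator_of_notMem fun h => hn ((hfloor n).1 h).symm, mul_zero]
  · intro h
    refine absurd (Finset.mem_range.2 ?_) h
    rw [Nat.floor_lt (by positivity), div_lt_iff₀ hdt]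
    exact htN

theorem integrable_cell_mul_indicator (x₀ : ℝ) {dx : ℝ} (hdx : 0 < dx) {c : ℤ → ℝ}
    (hc : Summable fun i => |c i|) (p q : ℝ) :
    Integrable fun z : ℝ × ℝ => c ⌊(z.1 - x₀) / dx⌋ * (Ico p q).indicator 1 z.2 := by
  have h : Integrable ((Ico p q).indicator (1 : ℝ → ℝ)) :=
    (integrable_indicator_iff measurableSet_Ico).2
      (integrableOn_const (by rw [Real.volume_Ico]; exact ENNReal.ofReal_ne_top))
  exact (integrable_cells x₀ hdx hc).mul_prod h

theorem isTimeDerivative_stepDerivative (x₀ : ℝ) {dx dt T : ℝ} (hdx : 0 < dx) (hdt : 0 < dt)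
    (W : ℕ → ℤ → ℝ) (hW : ∀ n, Summable fun i => |W n i|) {N : ℕ} (hN : T ≤ N * dt) :
    IsTimeDerivative T (stepFun x₀ dx dt W) (stepDerivative x₀ hdx hdt W hW N) := by
  refine ⟨?_, ?_⟩
  · have h : Integrable fun z : ℝ × ℝ => ∑ n ∈ Finset.range N,
        W n ⌊(z.1 - x₀) / dx⌋ * (Ico (n * dt) ((n + 1) * dt)).indicator 1 z.2 :=
      integrable_finsetSum _ fun n _ => integrable_cell_mul_indicator x₀ hdx (hW n) _ _
    refine IntegrableOn.locallyIntegrableOn (h.integrableOn.congr_fun ?_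
      (MeasurableSet.univ.prod measurableSet_Ioo))
    intro z hz
    exact (stepFun_eq_sum x₀ dx hdt W hz.2.1.le (hz.2.2.trans_le hN)).symm
  · intro φ hφ hcomp hsupp
    obtain ⟨C, hC⟩ := hφ.continuous.bounded_above_of_compact_support hcomp
    have hφm := hφ.continuous.measurable
    set φt : ℝ × ℝ → ℝ := fun z => fderiv ℝ φ z (0, 1) with hφt
    have hderiv : ∀ x t, HasDerivAt (fun s => φ (x, s)) (φt (x, t)) t := by
      intro x t
      have h1 : HasDerivAt (fun s : ℝ => (x, s)) ((0 : ℝ), (1 : ℝ)) t :=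
        (hasDerivAt_const t x).prodMk (hasDerivAt_id t)
      exact ((hφ.differentiable one_ne_zero) (x, t)).hasFDerivAt.comp_hasDerivAt t h1
    have hφtc : Continuous φt := (hφ.continuous_fderiv one_ne_zero).clm_apply continuous_const
    have hφt0 : ∀ z, z.2 ∉ Ioo 0 T → φt z = 0 := by
      intro z hz
      have hz' : z ∉ tsupport (fderiv ℝ φ) := fun h => hz (hsupp (tsupport_fderiv_subset ℝ h)).2
      rw [hφt]
      simp only [image_eq_zero_of_notMem_tsupport hz', zero_apply]
    have hφ0 : ∀ z, z.2 ∉ Ioo 0 T → φ z = 0 := fun z hz =>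
      image_eq_zero_of_notMem_tsupport fun h => hz (hsupp h).2
    obtain ⟨D, hD⟩ := hφtc.bounded_above_of_compact_support (hcomp.fderiv_apply ℝ (0, 1))
    rw [stepDerivative, JordanDecomposition.toJordanDecomposition_toSignedMeasure,
      integral_jordanOfDensity _ _ hφm hC]
    have hint : ∀ n t, Integrable fun x => φ (x, t) * W n ⌊(x - x₀) / dx⌋ := fun n t =>
      (integrable_cells x₀ hdx (hW n)).bdd_mul
        (hφm.comp (measurable_prodMk_const t)).aestronglyMeasurable (ae_of_all _ fun x => hC _)
    rw [integral_discreteTimes (g := fun z => φ z * jumpDensity x₀ dx dt W z)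
      (hφm.mul (measurable_jumpDensity x₀ dx dt W))
      ((integrable_jumpDensity x₀ hdx hdt hW N).bdd_mul hφm.aestronglyMeasurable (ae_of_all _ hC))]
    simp only [jumpDensity_succ x₀ dx hdt, mul_sub]
    simp_rw [integral_sub (hint _ _) (hint _ _)]
    -- The slab expansion is available only for times in `(0, T)`; elsewhere the derivative of `φ`
    -- vanishes.
    have hexp : ∀ z : ℝ × ℝ, stepFun x₀ dx dt W z.1 z.2 * deriv (fun s => φ (z.1, s)) z.2
        = ∑ n ∈ Finset.range N, φt z *
          (W n ⌊(z.1 - x₀) / dx⌋ * (Ico (n * dt) ((n + 1) * dt)).indicator 1 z.2) := by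
      intro z
      rw [(hderiv z.1 z.2).deriv, ← Finset.mul_sum]
      by_cases hz : z.2 ∈ Ioo 0 T
      · rw [← stepFun_eq_sum x₀ dx hdt W hz.1.le (hz.2.trans_le hN), mul_comm]
      · rw [hφt0 _ hz, zero_mul, mul_zero]
    have hint2 : ∀ n : ℕ, Integrable fun z : ℝ × ℝ => φt z *
        (W n ⌊(z.1 - x₀) / dx⌋ * (Ico (n * dt) ((n + 1) * dt)).indicator 1 z.2) := fun n =>
      (integrable_cell_mul_indicator x₀ hdx (hW n) _ _).bdd_mul
        hφtc.aestronglyMeasurable (ae_of_all _ hD)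
    -- Fubini, then the fundamental theorem of calculus in `t` on one slab.
    have hterm : ∀ n : ℕ, ∫ z : ℝ × ℝ, φt z *
        (W n ⌊(z.1 - x₀) / dx⌋ * (Ico (n * dt) ((n + 1) * dt)).indicator 1 z.2)
        = (∫ x, φ (x, ((n : ℝ) + 1) * dt) * W n ⌊(x - x₀) / dx⌋)
          - ∫ x, φ (x, n * dt) * W n ⌊(x - x₀) / dx⌋ := by
      intro n
      rw [← integral_sub (hint _ _) (hint _ _)]
      refine (integral_prod _ (hint2 n)).trans (integral_congr_ae (ae_of_all _ fun x => ?_))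
      have hle : n * dt ≤ ((n : ℝ) + 1) * dt := by linarith
      have hcx : Continuous fun t => φt (x, t) := hφtc.comp (by fun_prop)
      have hftc := intervalIntegral.integral_eq_sub_of_hasDerivAt
        (a := n * dt) (b := ((n : ℝ) + 1) * dt) (fun t _ => hderiv x t)
        (hcx.intervalIntegrable _ _)
      rw [intervalIntegral.integral_of_le hle, ← integral_Ico_eq_integral_Ioc] at hftc
      beta_reduce
      rw [← sub_mul, ← hftc, ← integral_indicator measurableSet_Ico, ← integral_mul_const]
      congr 1
      ext t
      by_cases ht : t ∈ Ico (n * dt) (((n : ℝ) + 1) * dt)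
      · simp only [indicator_of_mem ht, Pi.one_apply, mul_one]
      · simp only [indicator_of_notMem ht, mul_zero, zero_mul]
    simp_rw [hexp]
    rw [integral_finsetSum _ fun n _ => hint2 n]
    simp_rw [hterm]
    rw [← sub_eq_zero, sub_neg_eq_add, ← Finset.sum_add_distrib]
    -- Summation by parts: jump and slab terms combine into a telescoping sum, whose end terms
    -- vanish because `0` and `N dt ≥ T` lie outside `(0, T)`.
    have htel := Finset.sum_range_sub
      (fun n : ℕ => ∫ x, φ (x, (n : ℝ) * dt) * W n ⌊(x - x₀) / dx⌋) N
    have hz0 : ∫ x, φ (x, ((0 : ℕ) : ℝ) * dt) * W 0 ⌊(x - x₀) / dx⌋ = 0 :=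
      integral_eq_zero_of_ae (ae_of_all _ fun x => by
        simp [hφ0 (x, 0) (by simp)])
    have hzN : ∫ x, φ (x, (N : ℝ) * dt) * W N ⌊(x - x₀) / dx⌋ = 0 :=
      integral_eq_zero_of_ae (ae_of_all _ fun x => by
        simp [hφ0 (x, N * dt) (fun h => absurd h.2 (not_lt.2 hN))])
    rw [hz0, hzN, sub_zero] at htel
    refine Eq.trans (Finset.sum_congr rfl fun n _ => ?_) htel
    push_cast
    ring

/-! ### Conclusion -/

/-- The approximate solutions satisfy the weak hysteresis relationship. -/
theorem weakHysteresis_approx (f : ℝ → ℝ) (hf : ContDiff ℝ 2 f) (hconv : StrictConvexOn ℝ univ f)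
    (a T : ℝ) (ha : 0 < a)
    (u₀ w₀ : ℝ → ℝ) (hu₀ : Integrable u₀) (hw₀ : Integrable w₀)
    (hu₀BV : IsBV u₀) (hw₀BV : IsBV w₀)
    (hstrip : ∀ᵐ x : ℝ, |u₀ x - w₀ x| ≤ a)
    (x₀ dx dt : ℝ) (hdx : 0 < dx) (hdt : 0 < dt) (hCFL : CFL f u₀ dx dt) :
    WeakHysteresis a T u₀ w₀
      (uApprox f a x₀ dx dt u₀ w₀) (wApprox f a x₀ dx dt u₀ w₀) := by
  obtain ⟨B, hB⟩ := hu₀BV.exists_bound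
  obtain ⟨B', hB'⟩ := hw₀BV.exists_bound
  have hu2 := integrable_sq_of_bounded hu₀ hB
  have hw2 := integrable_sq_of_bounded hw₀ hB'
  have hl : 0 < dt / dx := div_pos hdt hdx
  have hlip := lipschitz_of_CFL (hf.of_le one_le_two) hdx hdt hCFL
  have h0 := admissible_zero f x₀ dt hdx hu₀ hw₀ hB hstrip
  have hadm := scheme_admissible hf.continuous hconv ha hl hlip h0
  set s := scheme f a x₀ dx dt u₀ w₀ with hs
  have hN : T ≤ ⌈T / dt⌉₊ * dt := (div_le_iff₀ hdt).1 (Nat.le_ceil _)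
  have hsu : ∀ n, Summable fun i => |(s n i).1 ^ 2| := fun n =>
    (summable_sq_of_summable_abs (hadm n).summable_fst).abs
  have hsw : ∀ n, Summable fun i => |(s n i).2 ^ 2| := fun n =>
    (summable_sq_of_summable_abs (hadm n).summable_snd).abs
  -- The energy inequality holds for every `t`, not merely almost every one.
  refine ⟨stepDerivative x₀ hdx hdt (fun n i => (s n i).2) (fun n => (hadm n).summable_snd)
    ⌈T / dt⌉₊, isTimeDerivative_stepDerivative x₀ hdx hdt (fun n i => (s n i).2)
      (fun n => (hadm n).summable_snd) hN, ae_of_all _ fun t => ?_⟩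
  have hiu : Integrable fun x => uApprox f a x₀ dx dt u₀ w₀ x t ^ 2 :=
    integrable_cells x₀ hdx (hsu ⌊t / dt⌋₊)
  have hiw : Integrable fun x => wApprox f a x₀ dx dt u₀ w₀ x t ^ 2 :=
    integrable_cells x₀ hdx (hsw ⌊t / dt⌋₊)
  refine ⟨hiu.sub hu2, hiw.sub hw2, ?_⟩
  rw [integral_sub hiu hu2, integral_sub hiw hw2]
  have eu : ∫ x, uApprox f a x₀ dx dt u₀ w₀ x t ^ 2 = dx * ∑' i, (s ⌊t / dt⌋₊ i).1 ^ 2 :=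
    integral_cells x₀ hdx (hsu ⌊t / dt⌋₊)
  have ew : ∫ x, wApprox f a x₀ dx dt u₀ w₀ x t ^ 2 = dx * ∑' i, (s ⌊t / dt⌋₊ i).2 ^ 2 :=
    integral_cells x₀ hdx (hsw ⌊t / dt⌋₊)
  have hen : energy (s ⌊t / dt⌋₊)
      = (∑' i, (s ⌊t / dt⌋₊ i).1 ^ 2) / 2 + (∑' i, (s ⌊t / dt⌋₊ i).2 ^ 2) / 2 := by
    rw [← tsum_div_const, ← tsum_div_const]
    exact ((hsu _).of_abs.div_const 2).tsum_add ((hsw _).of_abs.div_const 2)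
  have h1 := energy_zero_le f a x₀ dt hdx hu₀ hw₀ hu2 hw2
  have h2 := mul_le_mul_of_nonneg_left
    (scheme_energy_le hf.continuous hconv ha hl hlip h0 ⌊t / dt⌋₊) hdx.le
  have h3 := mul_le_mul_of_nonneg_left (totalVariation_stepDerivative_le x₀ hdx hdt
    (fun n i => (s n i).2) (fun n => (hadm n).summable_snd) ⌈T / dt⌉₊ t) ha.le
  rw [← hs] at h1 h2
  rw [hen] at h2
  rw [eu, ew]
  linarith

end PlayScheme

end

theorem mainTheorem4 (f : ℝ → ℝ) (hf : ContDiff ℝ 2 f) (hconv : StrictConvexOn ℝ univ f)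
    (a T : ℝ) (ha : 0 < a) (hT : 0 < T)
    (u₀ w₀ : ℝ → ℝ) (hu₀ : Integrable u₀) (hw₀ : Integrable w₀)
    (hu₀BV : PlayScheme.IsBV u₀) (hw₀BV : PlayScheme.IsBV w₀)
    (hstrip : ∀ᵐ x : ℝ, |u₀ x - w₀ x| ≤ a)
    (x₀ dx dt : ℝ) (hdx : 0 < dx) (hdt : 0 < dt) (hCFL : PlayScheme.CFL f u₀ dx dt) :
    PlayScheme.WeakHysteresis a T u₀ w₀
      (PlayScheme.uApprox f a x₀ dx dt u₀ w₀) (PlayScheme.wApprox f a x₀ dx dt u₀ w₀) :=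
  PlayScheme.weakHysteresis_approx f hf hconv a T ha u₀ w₀ hu₀ hw₀ hu₀BV hw₀BV hstrip
    x₀ dx dt hdx hdt hCFL
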